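/- Let $k$ be an algebraically closed field and let $A\simeq kQ_A/I_A$ be a presentation of a finite-dimensional triangular $k$-algebra: $Q_A$ is a finite quiver without oriented cycles and $I_A$ is an admissible ideal of $kQ_A$. Let $F:(\widetilde Q_A,\widetilde I_A)\to(Q_A,I_A)$ be a Galois covering of bound quivers such that $\widetilde A= k\widetilde Q_A/\widetilde I_A$ is strongly simply connected. Then no contour in $Q_A$ is a torsion contour: if $u,v$ are two non-trivial oriented paths in $Q_A$ with the same start point and the same end point, then it is impossible that $uv^{-1}$ is not homotopic to a trivial path while $(uv^{-1})^n$ is homotopic to a trivial path for some $n>1$. Here the following definitions are used. A bound quiver $(Q,I)$ is a locally finite quiver $Q$ with an admissible ideal $I$ of its path category $kQ$: every element of $I$ is a combination of paths of length at least $2$, and for each vertex all sufficiently long paths that start or end there lie in $I$. A minimal relation of $(Q,I)$ is an element $\sum_{i=1}^n\lambda_ip_i\in I(a,b)$ with $n\ge 2$, pairwise distinct paths $p_i$ of length at least $2$ and $\lambda_i\in k\setminus\{0\}$, such that $\sum_{j\in J}\lambda_jp_j\notin I(a,b)$ for every non-empty proper subset $J$ of $\{1,\dots,n\}$. Homotopy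 $\sim$ is the smallest equivalence relation on the walks of $Q$ (sequences of arrows and formal inverses of arrows) that is compatible with composition of walks and satisfies $\alpha\alpha^{-1}\sim\varepsilon_a$ and $\alpha^{-1}\alpha\sim\varepsilon_b$ for each arrow $\alpha:a\to b$, and $p_i\sim p_j$ whenever $p_i,p_j$ occur in the same minimal relation. The fundamental group of $(Q,I)$ at a vertex consists of the homotopy classes of closed walks at that vertex. A Galois covering $F:(\widetilde Q,\widetilde I)\to(Q,I)$, defined by the action of a group $G$ of automorphisms of the bound quiver $(\widetilde Q,\widetilde I)$, is a quiver map $\widetilde Q\to Q$, surjective on vertices and on arrows, with $F(\widetilde I)\subseteq I$, such that: the induced functor $k\widetilde Q/\widetilde I\to kQ/I$ is a covering functor, that is, the induced maps $\bigoplus_{F\tilde y=y}(k\widetilde Q/\widetilde I)(\tilde x,\tilde y)\to(kQ/I)(F\tilde x,y)$ and $\bigoplus_{F\tilde x=x}(k\widetilde Q/\widetilde I)(\tilde x,\tilde y)\to(kQ/I)(x,F\tilde y)$ are bijective; $Fg=F$ for all $g\in G$; the fibres of $F$ on vertices and on arrows are $G$-orbits; and only $1\in G$ fixes a vertex of $\widetilde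 Q$. The category $R=kQ/I$ is strongly simply connected if $Q$ has no oriented cycles, there are only finitely many paths between any two vertices of $Q$, and for every finite full convex subcategory $C$ of $R$ (its set of objects contains every vertex of every path of $Q$ between two of its members) and every presentation $C\simeq kQ'/I'$ as a bound quiver category, the fundamental group of $(Q',I')$ is trivial at every vertex. -/

import Mathlib

open CategoryTheory

universe u v u₁ v₁ u₂ v₂ w

noncomputable section

namespace BoundQuiver

/-! ### Path categories, ideals, bound quivers -/

section Ideals

variable (k : Type w) [Field k] {Q : Type u} [Quiver.{v} Q]

/-- The morphism space `kQ(a, b)` of the path category: formal `k`-linear combinations of the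
oriented paths from `a` to `b` (trivial path included when `a = b`). -/
abbrev PathSpace (a b : Q) : Type (max u v w) := Quiver.Path a b →₀ k

variable {k}

/-- The bilinear composition `kQ(a, b) × kQ(b, c) → kQ(a, c)`, paths being written from left to
right. -/
def pathMul {a b c : Q} : PathSpace k a b →ₗ[k] PathSpace k b c →ₗ[k] PathSpace k a c :=
  Finsupp.lsum k fun p => LinearMap.toSpanSingleton k _ (Finsupp.lmapDomain k k fun q => p.comp q)

theorem pathMul_single {a b c : Q} (p : Quiver.Path a b) (q : Quiver.Path b c) (s t : k) :
    pathMul (Finsupp.single p s) (Finsupp.single q t) = Finsupp.single (p.comp q) (s * t) := by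
  simp [pathMul, Finsupp.lmapDomain_apply, Finsupp.mapDomain_single]

theorem pathMul_assoc {a b c d : Q} (f : PathSpace k a b) (g : PathSpace k b c)
    (h : PathSpace k c d) : pathMul (pathMul f g) h = pathMul f (pathMul g h) := by
  induction f using Finsupp.induction_linear with
  | zero => simp
  | add f₁ f₂ h₁ h₂ => simp [h₁, h₂]
  | single p r =>
    induction g using Finsupp.induction_linear with
    | zero => simp
    | add f₁ f₂ h₁ h₂ => simp [h₁, h₂]
    | single q s =>
      induction h using Finsupp.induction_linear with
      | zero => simp
      | add f₁ f₂ h₁ h₂ => simp [h₁, h₂]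
      | single r' t => simp only [pathMul_single, Quiver.Path.comp_assoc, mul_assoc]

theorem nil_pathMul {a b : Q} (f : PathSpace k a b) :
    pathMul (Finsupp.single Quiver.Path.nil 1) f = f := by
  induction f using Finsupp.induction_linear with
  | zero => simp
  | add f₁ f₂ h₁ h₂ => simp [h₁, h₂]
  | single p r => simp [pathMul_single]

theorem pathMul_nil {a b : Q} (f : PathSpace k a b) :
    pathMul f (Finsupp.single Quiver.Path.nil 1) = f := by
  induction f using Finsupp.induction_linear with
  | zero => simp
  | add f₁ f₂ h₁ h₂ => simp [h₁, h₂]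
  | single p r => simp [pathMul_single]

variable (k Q)

/-- A two-sided ideal of the path category `kQ`. -/
structure PathIdeal where
  /-- the subspace `I(a, b)` of `kQ(a, b)` -/
  carrier : ∀ a b : Q, Submodule k (PathSpace k a b)
  mul_left_mem : ∀ {a b c : Q} (f : PathSpace k a b) {g : PathSpace k b c},
    g ∈ carrier b c → pathMul f g ∈ carrier a c
  mul_right_mem : ∀ {a b c : Q} {f : PathSpace k a b} (g : PathSpace k b c),
    f ∈ carrier a b → pathMul f g ∈ carrier a c

/-- A quiver without oriented cycles. -/
def IsTriangular : Prop := ∀ (a : Q) (p : Quiver.Path a a), p.length = 0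

variable {k Q}

/-- `(Q, I)` is a bound quiver: `Q` is locally finite and `I` is admissible, that is, `I` is
contained in the square of the arrow ideal, and for every vertex `a` all sufficiently long paths
that start or end at `a` belong to `I`. (For a finite quiver this is the usual condition
`J ^ m ⊆ I ⊆ J ^ 2` on the arrow ideal `J`.) -/
structure PathIdeal.IsBoundQuiver (I : PathIdeal k Q) : Prop where
  finite_star : ∀ a : Q, Finite (Quiver.Star a)
  finite_costar : ∀ a : Q, Finite (Quiver.Costar a)
  two_le_length : ∀ (a b : Q), ∀ ρ ∈ I.carrier a b, ∀ p ∈ ρ.support, 2 ≤ p.length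
  long_from : ∀ a : Q, ∃ N : ℕ, ∀ (b : Q) (p : Quiver.Path a b), N ≤ p.length →
    Finsupp.single p (1 : k) ∈ I.carrier a b
  long_to : ∀ b : Q, ∃ N : ℕ, ∀ (a : Q) (p : Quiver.Path a b), N ≤ p.length →
    Finsupp.single p (1 : k) ∈ I.carrier a b

/-! ### The `k`-category `kQ/I` -/

/-- The `k`-category `kQ/I`: its objects are the vertices of `Q`. -/
structure BoundCat (I : PathIdeal k Q) where
  /-- the vertex -/
  vertex : Q

namespace BoundCat

variable {I : PathIdeal k Q}

/-- Composition in `kQ/I`, induced by the composition in `kQ`. -/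
def compLin (a b c : Q) : (PathSpace k a b ⧸ I.carrier a b) →ₗ[k]
    (PathSpace k b c ⧸ I.carrier b c) →ₗ[k] (PathSpace k a c ⧸ I.carrier a c) :=
  (I.carrier a b).liftQ
    { toFun := fun f => (I.carrier b c).mapQ (I.carrier a c) (pathMul f)
        fun _ hg => I.mul_left_mem f hg
      map_add' := fun f f' => by ext; simp
      map_smul' := fun r f => by ext; simp }
    (by
      intro f hf
      rw [LinearMap.mem_ker]
      refine Submodule.linearMap_qext _ (LinearMap.ext fun g => ?_)
      simpa using I.mul_right_mem g hf)

theorem compLin_mk {a b c : Q} (f : PathSpace k a b) (g : PathSpace k b c) :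
    compLin (I := I) a b c (Submodule.Quotient.mk f) (Submodule.Quotient.mk g)
      = Submodule.Quotient.mk (pathMul f g) := rfl

instance category : Category (BoundCat I) where
  Hom a b := PathSpace k a.vertex b.vertex ⧸ I.carrier a.vertex b.vertex
  id a := Submodule.Quotient.mk (Finsupp.single Quiver.Path.nil 1)
  comp {a b c} f g := compLin a.vertex b.vertex c.vertex f g
  id_comp {a b} f := by
    obtain ⟨f, rfl⟩ := Submodule.Quotient.mk_surjective _ f
    rw [compLin_mk, nil_pathMul]
  comp_id {a b} f := by
    obtain ⟨f, rfl⟩ := Submodule.Quotient.mk_surjective _ f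
    rw [compLin_mk, pathMul_nil]
  assoc {a b c d} f g h := by
    obtain ⟨f, rfl⟩ := Submodule.Quotient.mk_surjective _ f
    obtain ⟨g, rfl⟩ := Submodule.Quotient.mk_surjective _ g
    obtain ⟨h, rfl⟩ := Submodule.Quotient.mk_surjective _ h
    rw [compLin_mk, compLin_mk, compLin_mk, compLin_mk, pathMul_assoc]

instance preadditive : Preadditive (BoundCat I) where
  homGroup a b := inferInstanceAs
    (AddCommGroup (PathSpace k a.vertex b.vertex ⧸ I.carrier a.vertex b.vertex))
  add_comp a b c f f' g :=
    LinearMap.congr_fun ((compLin a.vertex b.vertex c.vertex).map_add f f') g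
  comp_add a b c f g g' := ((compLin a.vertex b.vertex c.vertex) f).map_add g g'

instance linear : Linear k (BoundCat I) where
  homModule a b := inferInstanceAs
    (Module k (PathSpace k a.vertex b.vertex ⧸ I.carrier a.vertex b.vertex))
  smul_comp a b c r f g :=
    LinearMap.congr_fun ((compLin a.vertex b.vertex c.vertex).map_smul r f) g
  comp_smul a b c f r g := ((compLin a.vertex b.vertex c.vertex) f).map_smul r g

end BoundCat

end Ideals

/-! ### Homotopy of walks -/

section Homotopy

variable {k : Type w} [Field k] {Q : Type u} [Quiver.{v} Q]

/-- A walk: a sequence of arrows and of formal inverses of arrows. -/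
abbrev Walk (a b : Q) : Type (max u v) :=
  @Quiver.Path (Quiver.Symmetrify Q) _ a b

/-- An oriented path, seen as a walk. -/
def toWalk {a b : Q} (p : Quiver.Path a b) : Walk a b :=
  Quiver.Symmetrify.of.mapPath p

/-- The walk `w ^ n = w ⋯ w` (`n` factors). -/
def Walk.pow {a : Q} (w : Walk a a) : ℕ → Walk a a
  | 0 => Quiver.Path.nil
  | n + 1 => (Walk.pow w n).comp w

/-- `ρ = ∑ λᵢ pᵢ` (a linear combination of pairwise distinct paths with nonzero coefficients) is a
minimal relation of `(Q, I)`: it lies in `I(a, b)`, the `pᵢ` have length at least two, there are at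
least two of them, and no sum over a nonempty proper subset of the index set lies in `I(a, b)`. -/
structure IsMinimalRelation (I : PathIdeal k Q) {a b : Q} (ρ : PathSpace k a b) : Prop where
  mem : ρ ∈ I.carrier a b
  two_le_length : ∀ p ∈ ρ.support, 2 ≤ p.length
  two_le_card : 2 ≤ ρ.support.card
  minimal : ∀ J : Finset (Quiver.Path a b), J ⊂ ρ.support → J.Nonempty →
    (∑ p ∈ J, Finsupp.single p (ρ p)) ∉ I.carrier a b

/-- The homotopy relation on walks of `(Q, I)`: the smallest equivalence relation that cancels
`α α⁻¹` and `α⁻¹ α`, identifies the paths that occur in a minimal relation, and is compatible with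
the composition of walks. -/
inductive Homotopic (I : PathIdeal k Q) : ∀ {a b : Q}, Walk a b → Walk a b → Prop
  | refl {a b : Q} (p : Walk a b) : Homotopic I p p
  | symm {a b : Q} {p q : Walk a b} : Homotopic I p q → Homotopic I q p
  | trans {a b : Q} {p q r : Walk a b} : Homotopic I p q → Homotopic I q r → Homotopic I p r
  | arrow_inv {a b : Q} (α : a ⟶ b) :
      Homotopic I ((toWalk α.toPath).comp (toWalk α.toPath).reverse) Quiver.Path.nil
  | inv_arrow {a b : Q} (α : a ⟶ b) :
      Homotopic I ((toWalk α.toPath).reverse.comp (toWalk α.toPath)) Quiver.Path.nil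
  | relation {a b : Q} {ρ : PathSpace k a b} (hρ : IsMinimalRelation I ρ)
      {p q : Quiver.Path a b} (hp : p ∈ ρ.support) (hq : q ∈ ρ.support) :
      Homotopic I (toWalk p) (toWalk q)
  | whisker {a b c d : Q} (p : Walk a b) {q r : Walk b c} (s : Walk c d) :
      Homotopic I q r → Homotopic I ((p.comp q).comp s) ((p.comp r).comp s)

/-- Homotopy as a setoid on the walks from `a` to `b`. -/
def homotopySetoid (I : PathIdeal k Q) (a b : Q) : Setoid (Walk a b) where
  r := Homotopic I
  iseqv := ⟨.refl, .symm, .trans⟩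

/-- (The underlying set of) the fundamental group `π₁(Q, I, x)`: homotopy classes of closed walks
at `x`. -/
def FundamentalGroup (I : PathIdeal k Q) (x : Q) : Type (max u v) :=
  Quotient (homotopySetoid I x x)

/-- A closed walk is contractible if it is homotopic to a trivial path. -/
def IsContractible (I : PathIdeal k Q) {a : Q} (w : Walk a a) : Prop :=
  Homotopic I w Quiver.Path.nil

/-- A contour from `a` to `b`: a pair of non-trivial oriented paths from `a` to `b`. -/
def IsContour {a b : Q} (p q : Quiver.Path a b) : Prop := 0 < p.length ∧ 0 < q.length

/-- The closed walk `p q⁻¹`. -/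
def contourWalk {a b : Q} (p q : Quiver.Path a b) : Walk a a :=
  (toWalk p).comp (toWalk q).reverse

/-- A torsion contour: `p q⁻¹` is not contractible, but `(p q⁻¹) ^ n` is, for some `n > 1`. In other
words, the class of `p q⁻¹` is a non-trivial torsion element of the fundamental group. -/
structure IsTorsionContour (I : PathIdeal k Q) {a b : Q} (p q : Quiver.Path a b) : Prop where
  contour : IsContour p q
  not_contractible : ¬ IsContractible I (contourWalk p q)
  torsion : ∃ n : ℕ, 1 < n ∧ IsContractible I ((contourWalk p q).pow n)

end Homotopy

/-! ### Presentations -/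

section Presentations

variable (k : Type w) [Field k] {C : Type u} [Category.{v} C] {W : Type u₁} [Quiver.{v₁} W]

/-- The value in `C` of a path of `W`, when the arrows of `W` are sent to morphisms of `C`. -/
def evalPath (φ : W ⥤q C) {a : W} : ∀ {b : W}, Quiver.Path a b → (φ.obj a ⟶ φ.obj b)
  | _, .nil => 𝟙 _
  | _, .cons p α => evalPath φ p ≫ φ.map α

theorem evalPath_comp (φ : W ⥤q C) {a b c : W} (p : Quiver.Path a b) (q : Quiver.Path b c) :
    evalPath φ (p.comp q) = evalPath φ p ≫ evalPath φ q := by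
  induction q with
  | nil => simp [evalPath]
  | cons q α ih => simp [evalPath, ih]

variable [Preadditive C] [Linear k C]

/-- The `k`-linear functor `kW → C` that extends `φ`, on the morphisms from `a` to `b`. -/
def eval (φ : W ⥤q C) (a b : W) : PathSpace k a b →ₗ[k] (φ.obj a ⟶ φ.obj b) :=
  Finsupp.linearCombination k fun p => evalPath φ p

theorem eval_pathMul (φ : W ⥤q C) {a b c : W} (f : PathSpace k a b) (g : PathSpace k b c) :
    eval k φ a c (pathMul f g) = eval k φ a b f ≫ eval k φ b c g := by
  induction f using Finsupp.induction_linear with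
  | zero => simp
  | add f₁ f₂ h₁ h₂ => simp [h₁, h₂]
  | single p r =>
    induction g using Finsupp.induction_linear with
    | zero => simp
    | add f₁ f₂ h₁ h₂ => simp [h₁, h₂]
    | single q s =>
      rw [pathMul_single]
      simp only [eval, Finsupp.linearCombination_single, evalPath_comp, Linear.smul_comp,
        Linear.comp_smul, mul_smul, smul_comm r s]

/-- The kernel of the functor `kW → C` that extends `φ`, an ideal of `kW`. -/
def kernel (φ : W ⥤q C) : PathIdeal k W where
  carrier a b := LinearMap.ker (eval k φ a b)
  mul_left_mem f g hg := by
    rw [LinearMap.mem_ker] at hg ⊢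
    rw [eval_pathMul, hg, Limits.comp_zero]
  mul_right_mem {_ _ _ f} g hf := by
    rw [LinearMap.mem_ker] at hf ⊢
    rw [eval_pathMul, hf, Limits.zero_comp]

/-- `φ` defines a presentation `kW/I' ≅ C_S`, with `I' = kernel k φ`, of the full subcategory `C_S`
of `C` with object set `S`: the functor `kW → C` that extends `φ` is a bijection from the vertices
of `W` to `S`, is surjective on morphism spaces, and its kernel makes `W` a bound quiver. -/
structure IsPresentationOf (S : Set C) (φ : W ⥤q C) : Prop where
  bijOn : Set.BijOn φ.obj Set.univ S
  surjective : ∀ a b : W, Function.Surjective (eval k φ a b)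
  isBoundQuiver : (kernel k φ).IsBoundQuiver

end Presentations

/-! ### Strong simple connectedness -/

section StronglySimplyConnected

variable {k : Type w} [Field k] {Q : Type u} [Quiver.{v} Q]

/-- A set of vertices is convex if it contains every vertex of every oriented path between two of
its members. -/
def IsConvex (S : Set Q) : Prop :=
  ∀ ⦃a b c : Q⦄, a ∈ S → c ∈ S → ∀ (_ : Quiver.Path a b) (_ : Quiver.Path b c), b ∈ S

/-- `R = kQ/I` is strongly simply connected: it is triangular, there are only finitely many paths
between any two vertices, and for every presentation `kW/I'` of a finite full convex subcategory of
`R` the fundamental group of `(W, I')` is trivial (at each base point, since a convex subcategory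
need not be connected). -/
structure PathIdeal.IsStronglySimplyConnected (I : PathIdeal k Q) : Prop where
  triangular : IsTriangular Q
  finite_paths : ∀ x y : Q, Finite (Quiver.Path x y)
  trivial_fundamentalGroup : ∀ S : Set Q, S.Finite → IsConvex S →
    ∀ (W : Type u) [Quiver.{v} W] (φ : W ⥤q BoundCat I),
      IsPresentationOf k {c : BoundCat I | c.vertex ∈ S} φ →
      ∀ x : W, Subsingleton (FundamentalGroup (kernel k φ) x)

end StronglySimplyConnected

/-! ### Galois coverings -/

section Galois

variable {k : Type w} [Field k]

section CoveringFunctor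

variable {C : Type u₁} [Category.{v₁} C] [Preadditive C] {D : Type u₂} [Category.{v₂} D]
  [Preadditive D]

/-- The map `⨁_{F y' = y} C(x', y') → D(F x', y)` induced by `F`. -/
def coveringMapFrom (F : C ⥤ D) [F.Additive] (x' : C) (y : D) :
    (DirectSum {y' : C // F.obj y' = y} fun y' => (x' ⟶ y'.1)) →+ (F.obj x' ⟶ y) :=
  open Classical in
  DirectSum.toAddMonoid fun y' =>
    { toFun := fun f => F.map f ≫ eqToHom y'.2
      map_zero' := by simp
      map_add' := fun f g => by simp }

/-- The map `⨁_{F x' = x} C(x', y') → D(x, F y')` induced by `F`. -/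
def coveringMapTo (F : C ⥤ D) [F.Additive] (x : D) (y' : C) :
    (DirectSum {x' : C // F.obj x' = x} fun x' => (x'.1 ⟶ y')) →+ (x ⟶ F.obj y') :=
  open Classical in
  DirectSum.toAddMonoid fun x' =>
    { toFun := fun f => eqToHom x'.2.symm ≫ F.map f
      map_zero' := by simp
      map_add' := fun f g => by simp }

/-- A covering functor: the induced maps `⨁_{F y' = y} C(x', y') → D(F x', y)` and
`⨁_{F x' = x} C(x', y') → D(x, F y')` are all bijective. -/
structure IsCoveringFunctor (F : C ⥤ D) [F.Additive] : Prop where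
  bijective_from : ∀ x' y, Function.Bijective (coveringMapFrom F x' y)
  bijective_to : ∀ x y', Function.Bijective (coveringMapTo F x y')

end CoveringFunctor

variable {Q' : Type u₁} [Quiver.{v₁} Q'] {Q : Type u₂} [Quiver.{v₂} Q]

/-- The linear map `kQ'(a, b) → kQ(F a, F b)` induced by a quiver map. -/
def pathMap (F : Q' ⥤q Q) (a b : Q') : PathSpace k a b →ₗ[k] PathSpace k (F.obj a) (F.obj b) :=
  Finsupp.lmapDomain k k fun p => F.mapPath p

theorem pathMap_pathMul (F : Q' ⥤q Q) {a b c : Q'} (f : PathSpace k a b) (g : PathSpace k b c) :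
    pathMap F a c (pathMul f g) = pathMul (pathMap F a b f) (pathMap F b c g) := by
  induction f using Finsupp.induction_linear with
  | zero => simp
  | add f₁ f₂ h₁ h₂ => simp [h₁, h₂]
  | single p r =>
    induction g using Finsupp.induction_linear with
    | zero => simp
    | add f₁ f₂ h₁ h₂ => simp [h₁, h₂]
    | single q s =>
      rw [pathMul_single]
      simp only [pathMap, Finsupp.lmapDomain_apply, Finsupp.mapDomain_single, pathMul_single,
        Prefunctor.mapPath_comp]

/-- `F(I') ⊆ I`: `F` is a map of quivers with relations. -/
def MapsIdeal (F : Q' ⥤q Q) (I' : PathIdeal k Q') (I : PathIdeal k Q) : Prop :=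
  ∀ a b : Q', ∀ ρ ∈ I'.carrier a b, pathMap F a b ρ ∈ I.carrier (F.obj a) (F.obj b)

/-- The functor `kQ'/I' → kQ/I` induced by a quiver map `F` with `F(I') ⊆ I`. -/
def inducedFunctor (F : Q' ⥤q Q) {I' : PathIdeal k Q'} {I : PathIdeal k Q}
    (hF : MapsIdeal F I' I) : BoundCat I' ⥤ BoundCat I where
  obj a := ⟨F.obj a.vertex⟩
  map {a b} f := (I'.carrier a.vertex b.vertex).mapQ
    (I.carrier (F.obj a.vertex) (F.obj b.vertex)) (pathMap F a.vertex b.vertex)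
    (hF a.vertex b.vertex) f
  map_id a := by
    refine congrArg (Submodule.Quotient.mk (p := I.carrier _ _)) ?_
    simp [pathMap, Finsupp.lmapDomain_apply, Finsupp.mapDomain_single]
  map_comp {a b c} f g := by
    obtain ⟨f, rfl⟩ := Submodule.Quotient.mk_surjective _ f
    obtain ⟨g, rfl⟩ := Submodule.Quotient.mk_surjective _ g
    exact congrArg (Submodule.Quotient.mk (p := I.carrier _ _)) (pathMap_pathMul F f g)

instance inducedFunctor_additive (F : Q' ⥤q Q) {I' : PathIdeal k Q'} {I : PathIdeal k Q}
    (hF : MapsIdeal F I' I) : (inducedFunctor F hF).Additive where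
  map_add {_ _ f g} := LinearMap.map_add (Submodule.mapQ _ _ _ _) f g

/-- The quiver automorphism underlying an element of the automorphism group, as a quiver map. -/
def autMap (g : Aut (Quiv.of Q')) : Q' ⥤q Q' := g.hom

/-- The map induced on the set of all arrows by a quiver map. -/
def arrowMap (F : Q' ⥤q Q) (α : Quiver.Total Q') : Quiver.Total Q :=
  ⟨F.obj α.left, F.obj α.right, F.map α.hom⟩

/-- The quiver map `F` defines a Galois covering `(Q', I') → (Q, I)` of bound quivers, by the action
of the group `G` of quiver automorphisms of `Q'`: `G` preserves `I'`; `F` is surjective and maps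
`I'` into `I`; the induced functor `kQ'/I' → kQ/I` is a covering functor; `F g = F` for `g ∈ G`; the
fibres of `F` on vertices and on arrows are `G`-orbits; and `G` acts freely on the vertices. -/
structure IsGaloisCovering (F : Q' ⥤q Q) (I' : PathIdeal k Q') (I : PathIdeal k Q)
    (G : Subgroup (Aut (Quiv.of Q'))) : Prop where
  preserves : ∀ g ∈ G, MapsIdeal (autMap g) I' I'
  surjective_vertices : Function.Surjective F.obj
  surjective_arrows : Function.Surjective (arrowMap F)
  mapsIdeal : MapsIdeal F I' I
  isCoveringFunctor : IsCoveringFunctor (inducedFunctor F mapsIdeal)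
  invariant : ∀ g ∈ G, autMap g ⋙q F = F
  vertex_fibre : ∀ x y : Q', F.obj x = F.obj y → ∃ g ∈ G, (autMap g).obj x = y
  arrow_fibre : ∀ α β : Quiver.Total Q', arrowMap F α = arrowMap F β →
    ∃ g ∈ G, arrowMap (autMap g) α = β
  free : ∀ g ∈ G, ∀ x : Q', (autMap g).obj x = x → g = 1

end Galois

end BoundQuiver

end

/-! Lifting walks makes them act on the fibres of `F` by monodromy. The covering functor condition
makes `I` homogeneous with respect to the end points of lifts, so all paths of a minimal relation
have lifts with the same end points and monodromy is a homotopy invariant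
(`IsGaloisCovering.monodromy_eq_of_homotopic`).

Let `w` be the closed walk of a contour `p`, `q`, and let `x` lie over its start. The monodromy of
`w` sends `x` to `g • x` for some `g ∈ G`; it commutes with `G`, so that of `w ^ n` sends `x` to `g
^ n • x`. If `w ^ n` is contractible, freeness gives `g ^ n = 1`. The lift of `p` from `x` and the
lift of `q` from `g • x` end at a common vertex `y`.

The heart is that then `g = 1` (`PathIdeal.IsStronglySimplyConnected.eq_one_of_paths`). The convex
hull of the orbits of `x` and `y` under the powers of `g` is finite, stable under `g` and, thanks to
the two lifted paths, connected. Its number of components, which is `1`, equals the sum over its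
vertices `s` of `1` minus the number of components of the proper successors of `s`
(`card_comp_eq_sum`). The summand is invariant under the free action of the group generated by `g`,
so the order of that group divides `1`.

The counting formula comes from removing sources one by one. It rests on a separation property
(`IsSourceOf.incl_injective`): distinct components of the successors of a source `x` stay distinct
when only `x` is removed, since otherwise a closed walk through `x` would have nonzero value under a
homotopy-invariant integer weight.

Once `g = 1`, both paths lift to paths with the same end points in the cover. Their contour is
contractible there, within a finite convex hull, and `F` carries this homotopy down to `Q`. -/

open CategoryTheory

noncomputable section

namespace BoundQuiver

/-! ### Transport along walks -/

section Transport

variable {k : Type w} [Field k] {Q : Type u} [Quiver.{v} Q] {V : Q → Type u₁}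

/-- The bijection attached to an arrow or to a formal inverse of an arrow. -/
def stepTransport (τ : ∀ ⦃a b : Q⦄, (a ⟶ b) → (V a ≃ V b)) {a b : Q} :
    ((a ⟶ b) ⊕ (b ⟶ a)) → (V a ≃ V b)
  | .inl α => τ α
  | .inr α => (τ α).symm

/-- The bijection obtained by composing the bijections `τ` along a walk. -/
def transport (τ : ∀ ⦃a b : Q⦄, (a ⟶ b) → (V a ≃ V b)) {a : Q} :
    ∀ {b : Q}, Walk a b → (V a ≃ V b)
  | _, .nil => Equiv.refl _
  | _, .cons w e => (transport τ w).trans (stepTransport τ e)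

variable (τ : ∀ ⦃a b : Q⦄, (a ⟶ b) → (V a ≃ V b))

theorem transport_comp {a b c : Q} (w : Walk a b) (w' : Walk b c) :
    transport τ (w.comp w') = (transport τ w).trans (transport τ w') := by
  induction w' with
  | nil => rfl
  | cons w' e ih =>
    change (transport τ (w.comp w')).trans (stepTransport τ e) = _
    rw [ih]
    rfl

theorem Walk.reverse_cons {a b c : Q} (w : Walk a b) (e : (b ⟶ c) ⊕ (c ⟶ b)) :
    (Quiver.Path.cons w e : Walk a c).reverse
      = (Quiver.Path.cons .nil e.swap : Walk c b).comp w.reverse := rfl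

theorem transport_reverse {a b : Q} (w : Walk a b) :
    transport τ (Quiver.Path.reverse w) = (transport τ w).symm := by
  induction w with
  | nil => rfl
  | cons w e ih =>
    refine (congrArg (transport τ) (Walk.reverse_cons w e)).trans ?_
    refine (transport_comp τ _ _).trans ?_
    rw [ih]
    rcases e with e | e <;> rfl

@[simp]
theorem transport_toWalk_nil (a : Q) :
    transport τ (toWalk (Quiver.Path.nil : Quiver.Path a a)) = Equiv.refl _ := rfl

theorem transport_toWalk_cons {a b c : Q} (p : Quiver.Path a b) (α : b ⟶ c) :
    transport τ (toWalk (p.cons α)) = (transport τ (toWalk p)).trans (τ α) := rfl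

theorem transport_pow {a : Q} (w : Walk a a) (n : ℕ) (x : V a) :
    transport τ (w.pow n) x = (transport τ w)^[n] x := by
  induction n with
  | zero => rfl
  | succ n ih => rw [Walk.pow, transport_comp, Function.iterate_succ_apply', ← ih]; rfl

/-- Transport depends only on the homotopy class of a walk if it agrees on the paths that occur in
a common minimal relation. -/
theorem Homotopic.transport_eq {I : PathIdeal k Q}
    (h : ∀ {a b : Q} {ρ : PathSpace k a b}, IsMinimalRelation I ρ → ∀ p ∈ ρ.support,
      ∀ q ∈ ρ.support, transport τ (toWalk p) = transport τ (toWalk q))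
    {a b : Q} {w w' : Walk a b} (H : Homotopic I w w') : transport τ w = transport τ w' := by
  induction H with
  | refl => rfl
  | symm _ ih => exact ih.symm
  | trans _ _ ih ih' => exact ih.trans ih'
  | arrow_inv α => rw [transport_comp, transport_reverse]; exact Equiv.self_trans_symm _
  | inv_arrow α => rw [transport_comp, transport_reverse]; exact Equiv.symm_trans_self _
  | relation hρ hp hq => exact h hρ _ hp _ hq
  | whisker p s _ ih => simp only [transport_comp, ih]

end Transport

/-! ### Functoriality of homotopy -/

section Functoriality

variable {k : Type w} [Field k] {W : Type u₁} [Quiver.{v₁} W] {Q : Type u} [Quiver.{v} Q]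
  (ψ : W ⥤q Q) {J : PathIdeal k W} {I : PathIdeal k Q}

/-- The image of a walk under a quiver map. -/
def walkMap {a : W} : ∀ {b : W}, Walk a b → Walk (ψ.obj a) (ψ.obj b)
  | _, .nil => .nil
  | _, .cons w e => .cons (walkMap w) (Sum.map ψ.map ψ.map e)

theorem walkMap_toWalk {a b : W} (p : Quiver.Path a b) :
    walkMap ψ (toWalk p) = toWalk (ψ.mapPath p) := by
  induction p with
  | nil => rfl
  | cons p α ih => exact congrArg (fun w => Quiver.Path.cons w (Sum.inl (ψ.map α))) ih

theorem walkMap_comp {a b c : W} (w : Walk a b) (w' : Walk b c) :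
    walkMap ψ (w.comp w') = (walkMap ψ w).comp (walkMap ψ w') := by
  induction w' with
  | nil => rfl
  | cons w' e ih => exact congrArg (fun w => Quiver.Path.cons w (Sum.map ψ.map ψ.map e)) ih

theorem walkMap_reverse {a b : W} (w : Walk a b) :
    walkMap ψ w.reverse = (walkMap ψ w).reverse := by
  induction w with
  | nil => rfl
  | cons w e ih =>
    refine (congrArg (walkMap ψ) (Walk.reverse_cons w e)).trans ?_
    refine (walkMap_comp ψ _ _).trans ?_
    rw [ih]
    rcases e with e | e <;> rfl

theorem length_mapPath {a b : W} (p : Quiver.Path a b) : (ψ.mapPath p).length = p.length := by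
  induction p with
  | nil => rfl
  | cons p α ih => exact congrArg Nat.succ ih

theorem support_pathMap (hinj : ∀ a b : W, Function.Injective (ψ.mapPath (a := a) (b := b)))
    {a b : W} (ρ : PathSpace k a b) :
    (pathMap ψ a b ρ).support = ρ.support.map ⟨_, hinj a b⟩ := by
  classical
  rw [Finset.map_eq_image]
  exact Finsupp.mapDomain_support_of_injective (hinj a b) ρ

theorem pathMap_apply_mapPath
    (hinj : ∀ a b : W, Function.Injective (ψ.mapPath (a := a) (b := b)))
    {a b : W} (ρ : PathSpace k a b) (p : Quiver.Path a b) :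
    pathMap ψ a b ρ (ψ.mapPath p) = ρ p :=
  Finsupp.mapDomain_apply (hinj a b) ρ p

/-- Injectivity on paths matches subsums upstairs with subsums downstairs; since `ψ` also reflects
membership in the ideal, a proper subsum in `I` would pull back to one in `J`. The two hypotheses
hold both for inclusions of convex full subquivers and for the covering `F`. -/
theorem IsMinimalRelation.pathMap
    (hinj : ∀ a b : W, Function.Injective (ψ.mapPath (a := a) (b := b)))
    (hmem : ∀ (a b : W) (ρ : PathSpace k a b),
      pathMap ψ a b ρ ∈ I.carrier _ _ ↔ ρ ∈ J.carrier a b)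
    {a b : W} {ρ : PathSpace k a b} (hρ : IsMinimalRelation J ρ) :
    IsMinimalRelation I (pathMap ψ a b ρ) where
  mem := (hmem a b ρ).2 hρ.mem
  two_le_length p hp := by
    rw [support_pathMap ψ hinj, Finset.mem_map] at hp
    obtain ⟨p, hp, rfl⟩ := hp
    simpa [length_mapPath] using hρ.two_le_length p hp
  two_le_card := by
    rw [support_pathMap ψ hinj, Finset.card_map]
    exact hρ.two_le_card
  minimal K hK hK' := by
    classical
    rw [support_pathMap ψ hinj] at hK
    obtain ⟨K, rfl⟩ : ∃ L : Finset (Quiver.Path a b), L.map ⟨_, hinj a b⟩ = K := by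
      obtain ⟨L, _, hL⟩ := Finset.subset_map_iff.1 hK.1
      exact ⟨L, hL.symm⟩
    rw [Finset.map_ssubset_map] at hK
    refine fun hmemK => hρ.minimal K hK (by simpa using hK') ((hmem a b _).1 ?_)
    convert hmemK using 1
    rw [map_sum, Finset.sum_map]
    refine Finset.sum_congr rfl fun p _ => ?_
    rw [Function.Embedding.coeFn_mk, pathMap_apply_mapPath ψ hinj]
    exact Finsupp.mapDomain_single

theorem Homotopic.map
    (hinj : ∀ a b : W, Function.Injective (ψ.mapPath (a := a) (b := b)))
    (hmem : ∀ (a b : W) (ρ : PathSpace k a b),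
      pathMap ψ a b ρ ∈ I.carrier _ _ ↔ ρ ∈ J.carrier a b)
    {a b : W} {w w' : Walk a b} (H : Homotopic J w w') :
    Homotopic I (walkMap ψ w) (walkMap ψ w') := by
  induction H with
  | refl => exact .refl _
  | symm _ ih => exact ih.symm
  | trans _ _ ih ih' => exact ih.trans ih'
  | arrow_inv α => exact .arrow_inv (ψ.map α)
  | inv_arrow α => exact .inv_arrow (ψ.map α)
  | @relation a b ρ hρ p q hp hq =>
    rw [walkMap_toWalk, walkMap_toWalk]
    refine .relation (hρ.pathMap ψ hinj hmem) ?_ ?_ <;> rw [support_pathMap ψ hinj]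
    · exact Finset.mem_map_of_mem ⟨_, hinj a b⟩ hp
    · exact Finset.mem_map_of_mem ⟨_, hinj a b⟩ hq
  | whisker p s _ ih =>
    simp only [walkMap_comp]
    exact .whisker _ _ ih

end Functoriality

/-! ### Full subquivers -/

section FullSubquiver

variable {k : Type w} [Field k] {Q : Type u} [Quiver.{v} Q]

/-- The full subquiver of `Q` with vertex set `S`. -/
structure FullSubquiver (S : Set Q) where
  /-- the vertex -/
  vertex : Q
  mem : vertex ∈ S

instance (S : Set Q) : Quiver.{v} (FullSubquiver S) where
  Hom s t := s.vertex ⟶ t.vertex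

/-- The inclusion of a full subquiver. -/
def incl (S : Set Q) : FullSubquiver S ⥤q Q where
  obj s := s.vertex
  map α := α

/-- A path can be recovered from its image arrow by arrow from its start. This applies to full
subquivers and to Galois coverings alike. -/
theorem mapPath_injective_of_star {W : Type u₁} [Quiver.{v₁} W] (ψ : W ⥤q Q)
    (h : ∀ a, Function.Injective (ψ.star a)) (a b : W) :
    Function.Injective (ψ.mapPath (a := a) (b := b)) := by
  intro p q hpq
  have := ψ.pathStar_injective h a (a₁ := ⟨b, p⟩) (a₂ := ⟨b, q⟩)
    (congrArg (Sigma.mk (ψ.obj b)) hpq)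
  simpa using this

theorem mapPath_incl_injective (S : Set Q) (a b : FullSubquiver S) :
    Function.Injective ((incl S).mapPath (a := a) (b := b)) := by
  refine mapPath_injective_of_star _ (fun a => ?_) a b
  rintro ⟨⟨s, hs⟩, α⟩ ⟨⟨t, ht⟩, β⟩ h
  change (⟨s, α⟩ : Quiver.Star a.vertex) = ⟨t, β⟩ at h
  cases h
  rfl

theorem exists_mapPath_incl {S : Set Q} (hS : IsConvex S) {a b : FullSubquiver S}
    (p : Quiver.Path ((incl S).obj a) ((incl S).obj b)) :
    ∃ p' : Quiver.Path a b, (incl S).mapPath p' = p := by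
  suffices ∀ (c : Q) (hc : c ∈ S) (p : Quiver.Path a.vertex c),
      ∃ p' : Quiver.Path a (⟨c, hc⟩ : FullSubquiver S), (incl S).mapPath p' = p from
    this b.vertex b.mem p
  intro c hc p
  induction p with
  | nil => exact ⟨.nil, rfl⟩
  | @cons d c p α ih =>
    have hd : d ∈ S := hS a.mem hc p α.toPath
    obtain ⟨p', rfl⟩ := ih hd
    exact ⟨p'.cons (show (⟨d, hd⟩ : FullSubquiver S) ⟶ ⟨c, hc⟩ from α), rfl⟩

/-- The quiver map from a full subquiver to `kQ/I`. -/
def toBoundCat (I : PathIdeal k Q) (S : Set Q) : FullSubquiver S ⥤q BoundCat I where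
  obj s := ⟨(incl S).obj s⟩
  map {s t} α := Submodule.Quotient.mk (p := I.carrier ((incl S).obj s) ((incl S).obj t))
    (Finsupp.single ((incl S).map α).toPath 1)

theorem evalPath_toBoundCat (I : PathIdeal k Q) (S : Set Q) {a b : FullSubquiver S}
    (p : Quiver.Path a b) : evalPath (toBoundCat I S) p =
      Submodule.Quotient.mk (p := I.carrier ((incl S).obj a) ((incl S).obj b)) (Finsupp.single ((incl S).mapPath p) 1) := by
  induction p with
  | nil => rfl
  | @cons c d p α ih =>
    rw [evalPath, ih]
    refine (BoundCat.compLin_mk _ _).trans (congrArg (Submodule.Quotient.mk) ?_)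
    exact (pathMul_single _ _ _ _).trans (by rw [one_mul]; rfl)

theorem eval_toBoundCat (I : PathIdeal k Q) (S : Set Q) {a b : FullSubquiver S}
    (ρ : PathSpace k a b) : eval k (toBoundCat I S) a b ρ =
      Submodule.Quotient.mk (p := I.carrier ((incl S).obj a) ((incl S).obj b)) (pathMap (incl S) a b ρ) := by
  induction ρ using Finsupp.induction_linear with
  | zero => simp only [map_zero]; rfl
  | add f g hf hg => simp only [map_add, hf, hg]; rfl
  | single p r =>
    rw [eval, Finsupp.linearCombination_single, evalPath_toBoundCat, pathMap,
      Finsupp.lmapDomain_apply, Finsupp.mapDomain_single]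
    refine (Submodule.Quotient.mk_smul (I.carrier ((incl S).obj a) ((incl S).obj b)) r _).symm.trans
      (congrArg Submodule.Quotient.mk ?_)
    rw [Finsupp.smul_single, smul_eq_mul, mul_one]

theorem mem_kernel_toBoundCat (I : PathIdeal k Q) (S : Set Q) {a b : FullSubquiver S}
    (ρ : PathSpace k a b) : pathMap (incl S) a b ρ ∈ I.carrier ((incl S).obj a) ((incl S).obj b) ↔
      ρ ∈ (kernel k (toBoundCat I S)).carrier a b := by
  rw [← Submodule.Quotient.mk_eq_zero, ← eval_toBoundCat]
  rfl

theorem single_mem_kernel_toBoundCat (I : PathIdeal k Q) (S : Set Q) {a b : FullSubquiver S}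
    (p : Quiver.Path a b)
    (h : Finsupp.single ((incl S).mapPath p) (1 : k) ∈ I.carrier ((incl S).obj a) ((incl S).obj b)) :
    Finsupp.single p (1 : k) ∈ (kernel k (toBoundCat I S)).carrier a b := by
  rw [← mem_kernel_toBoundCat, pathMap, Finsupp.lmapDomain_apply, Finsupp.mapDomain_single]
  exact h

/-- A full convex subcategory of `kQ/I` is presented by the full subquiver on its objects. -/
theorem isPresentationOf_toBoundCat {I : PathIdeal k Q} (hI : I.IsBoundQuiver) {S : Set Q}
    (hS : IsConvex S) :
    IsPresentationOf k {c : BoundCat I | c.vertex ∈ S} (toBoundCat I S) where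
  bijOn := by
    refine ⟨fun s _ => s.mem, fun s _ t _ h => ?_, ?_⟩
    · cases s; cases t; cases h; rfl
    · rintro ⟨c⟩ hc
      exact ⟨⟨c, hc⟩, trivial, rfl⟩
  surjective a b f := by
    obtain ⟨f, rfl⟩ := Submodule.Quotient.mk_surjective (I.carrier ((incl S).obj a) ((incl S).obj b)) f
    suffices ∃ ρ, pathMap (incl S) a b ρ = f by
      obtain ⟨ρ, rfl⟩ := this
      exact ⟨ρ, eval_toBoundCat I S ρ⟩
    exact Finsupp.mapDomain_surjective (fun p => exists_mapPath_incl hS p) f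
  isBoundQuiver :=
    { finite_star := fun a => by
        have := hI.finite_star a.vertex
        refine Finite.of_injective (β := Quiver.Star a.vertex) ((incl S).star a) ?_
        rintro ⟨⟨s, hs⟩, α⟩ ⟨⟨t, ht⟩, β⟩ h
        change (⟨s, α⟩ : Quiver.Star a.vertex) = ⟨t, β⟩ at h
        cases h
        rfl
      finite_costar := fun a => by
        have := hI.finite_costar a.vertex
        refine Finite.of_injective (β := Quiver.Costar a.vertex) ((incl S).costar a) ?_
        rintro ⟨⟨s, hs⟩, α⟩ ⟨⟨t, ht⟩, β⟩ h
        change (⟨s, α⟩ : Quiver.Costar a.vertex) = ⟨t, β⟩ at h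
        cases h
        rfl
      two_le_length := fun a b ρ hρ p hp => by
        have h := hI.two_le_length _ _ _ ((mem_kernel_toBoundCat I S ρ).2 hρ)
          ((incl S).mapPath p) (by
            rw [support_pathMap _ (mapPath_incl_injective S)]
            exact Finset.mem_map_of_mem ⟨_, mapPath_incl_injective S a b⟩ hp)
        rwa [length_mapPath] at h
      long_from := fun a => by
        obtain ⟨N, hN⟩ := hI.long_from a.vertex
        exact ⟨N, fun b p hp => single_mem_kernel_toBoundCat I S p (hN _ _ (hp.trans_eq (length_mapPath _ p).symm))⟩
      long_to := fun b => by
        obtain ⟨N, hN⟩ := hI.long_to b.vertex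
        exact ⟨N, fun a p hp => single_mem_kernel_toBoundCat I S p (hN _ _ (hp.trans_eq (length_mapPath _ p).symm))⟩ }

/-- In a strongly simply connected category, closed walks in a finite convex full subquiver are
contractible. -/
theorem PathIdeal.IsStronglySimplyConnected.homotopic_nil {I : PathIdeal k Q}
    (hI' : I.IsStronglySimplyConnected) (hI : I.IsBoundQuiver) {S : Set Q} (hfin : S.Finite)
    (hS : IsConvex S) {x : FullSubquiver S} (w : Walk x x) :
    Homotopic (kernel k (toBoundCat I S)) w Quiver.Path.nil := by
  have := hI'.trivial_fundamentalGroup S hfin hS (FullSubquiver S) (toBoundCat I S)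
    (isPresentationOf_toBoundCat hI hS) x
  exact Quotient.exact (s := homotopySetoid (kernel k (toBoundCat I S)) x x)
    (Subsingleton.elim (α := FundamentalGroup (kernel k (toBoundCat I S)) x) _ _)

end FullSubquiver

/-! ### Connected components of full subquivers -/

section Components

variable {k : Type w} [Field k] {Q : Type u} [Quiver.{v} Q]

/-- The set of connected components of the full subquiver on `S`. -/
def Comp (S : Set Q) : Type u := Quot fun s t : S => Nonempty (s.1 ⟶ t.1)

/-- The connected component of a vertex. -/
def Comp.mk {S : Set Q} (s : Q) (hs : s ∈ S) : Comp S := Quot.mk _ ⟨s, hs⟩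

theorem Comp.exists_mk {S : Set Q} (c : Comp S) : ∃ (s : Q) (hs : s ∈ S), Comp.mk s hs = c := by
  obtain ⟨⟨s, hs⟩, rfl⟩ := Quot.exists_rep c
  exact ⟨s, hs, rfl⟩

theorem Comp.mk_eq_of_arrow {S : Set Q} {s t : Q} (hs : s ∈ S) (ht : t ∈ S) (α : s ⟶ t) :
    Comp.mk s hs = Comp.mk t ht := Quot.sound ⟨α⟩

theorem Comp.mk_eq_of_path {S : Set Q} (hS : IsConvex S) {s t : Q} (hs : s ∈ S) (ht : t ∈ S)
    (p : Quiver.Path s t) : Comp.mk s hs = Comp.mk t ht := by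
  induction p with
  | nil => rfl
  | @cons c t p α ih =>
    have hc : c ∈ S := hS hs ht p α.toPath
    exact (ih hc).trans (Comp.mk_eq_of_arrow hc ht α)

/-- A quiver map that sends `S` to `T` maps the components of `S` to those of `T`. -/
def Comp.map {W : Type u₁} [Quiver.{v₁} W] (ψ : Q ⥤q W) {S : Set Q} {T : Set W}
    (h : Set.MapsTo ψ.obj S T) : Comp S → Comp T :=
  Quot.map (fun s => ⟨ψ.obj s.1, h s.2⟩) fun _ _ ⟨α⟩ => ⟨ψ.map α⟩

/-- The map on components induced by an inclusion of vertex sets. -/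
abbrev Comp.incl {S T : Set Q} (h : S ⊆ T) : Comp S → Comp T := Comp.map (𝟭q Q) h

theorem Comp.finite {S : Set Q} (hS : S.Finite) : Finite (Comp S) := by
  have := hS.to_subtype
  exact Quot.finite _

/-- The proper successors of `x` in `S`. -/
def Above (S : Set Q) (x : Q) : Set Q := {y ∈ S \ {x} | Nonempty (Quiver.Path x y)}

/-- `x` is a source of the full subquiver on `S`. -/
structure IsSourceOf (S : Set Q) (x : Q) : Prop where
  mem : x ∈ S
  isEmpty : ∀ s ∈ S, IsEmpty (s ⟶ x)

/-- By convexity the last arrow of a nontrivial path would start inside `S`. -/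
theorem IsSourceOf.eq_of_path {S : Set Q} {x s : Q} (hx : IsSourceOf S x) (hS : IsConvex S)
    (hs : s ∈ S) (p : Quiver.Path s x) : s = x := by
  cases p with
  | nil => rfl
  | cons p α => exact ((hx.isEmpty _ (hS hs hx.mem p α.toPath)).false α).elim

theorem IsSourceOf.isConvex_diff {S : Set Q} {x : Q} (hx : IsSourceOf S x) (hS : IsConvex S) :
    IsConvex (S \ {x}) := by
  rintro a b c ⟨ha, hax⟩ ⟨hc, -⟩ p q
  refine ⟨hS ha hc p q, fun hb => hax ?_⟩
  cases hb
  exact hx.eq_of_path hS ha p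

theorem exists_isSourceOf (hQ : IsTriangular Q) {S : Set Q} (hfin : S.Finite)
    (hne : S.Nonempty) : ∃ x, IsSourceOf S x := by
  let _ : Preorder Q :=
    { le := fun a b => Nonempty (Quiver.Path a b)
      le_refl := fun _ => ⟨.nil⟩
      le_trans := fun _ _ _ ⟨p⟩ ⟨q⟩ => ⟨p.comp q⟩ }
  obtain ⟨x, hx⟩ := hfin.exists_minimal hne
  refine ⟨x, hx.prop, fun s hs => ⟨fun α => ?_⟩⟩
  -- Reachability is only taken as a preorder, so minimality returns a path from `x` to `s`; with
  -- `α` it closes up to an oriented cycle.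
  obtain ⟨p⟩ : x ≤ s := hx.le_of_le hs ⟨α.toPath⟩
  simpa using hQ x (p.cons α)

theorem IsSourceOf.mem_above {S : Set Q} {x y : Q} (hx : IsSourceOf S x) (hy : y ∈ S)
    (α : x ⟶ y) : y ∈ Above S x := by
  refine ⟨⟨hy, fun h => ?_⟩, ⟨α.toPath⟩⟩
  cases h
  exact (hx.isEmpty _ hx.mem).false α

/-- Each component of the set of proper successors of a source contains a direct successor. -/
theorem IsSourceOf.exists_arrow {S : Set Q} {x : Q} (hx : IsSourceOf S x) (hS : IsConvex S)
    (c : Comp (Above S x)) :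
    ∃ (y : Q) (hy : y ∈ Above S x), Nonempty (x ⟶ y) ∧ Comp.mk y hy = c := by
  obtain ⟨t, ht, rfl⟩ := c.exists_mk
  obtain ⟨p⟩ := ht.2
  induction p with
  | nil => exact (ht.1.2 rfl).elim
  | @cons d t p α ih =>
    have hd : d ∈ S := hS hx.mem ht.1.1 p α.toPath
    -- Either `t` is itself a direct successor of `x`, or the previous vertex is a proper successor
    -- in the same component as `t`.
    by_cases hdx : d = x
    · subst hdx
      exact ⟨t, ht, ⟨α⟩, rfl⟩
    · have hd' : d ∈ Above S x := ⟨⟨hd, hdx⟩, ⟨p⟩⟩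
      obtain ⟨y, hy, hα, h⟩ := ih hd'
      exact ⟨y, hy, hα, h.trans (Comp.mk_eq_of_arrow hd' ht α)⟩

/-! ### An integer weight on walks that detects a component of the successors of a source. -/

open Classical in
/-- The weight of a pair of vertices: `1` for the source `x` and a successor in the component `c`,
and `0` otherwise. -/
def sourceWeight (S : Set Q) (x : Q) (c : Comp (Above S x)) (s t : Q) : ℤ :=
  if s = x ∧ ∃ ht : t ∈ Above S x, Comp.mk t ht = c then 1 else 0

theorem sourceWeight_of_ne {S : Set Q} {x : Q} (c : Comp (Above S x)) {s : Q} (t : Q)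
    (hs : s ≠ x) : sourceWeight S x c s t = 0 :=
  if_neg fun h => hs h.1

theorem sourceWeight_self {S : Set Q} {x : Q} (c : Comp (Above S x)) (s : Q) :
    sourceWeight S x c s s = 0 := by
  refine if_neg ?_
  rintro ⟨rfl, h, -⟩
  exact h.1.2 rfl

/-- Once a path from `x` has left `x`, it stays in one component of `Above S x`; a path that starts
elsewhere never meets `x`. Hence the weight of a path depends only on its end points. -/
theorem IsSourceOf.sourceWeight_add {S : Set Q} {x : Q} (hx : IsSourceOf S x) (hS : IsConvex S)
    (c : Comp (Above S x)) {s t t' : Q} (hs : s ∈ S) (ht : t ∈ S) (ht' : t' ∈ S)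
    (p : Quiver.Path s t) (α : t ⟶ t') :
    sourceWeight S x c s t + sourceWeight S x c t t' = sourceWeight S x c s t' := by
  by_cases hsx : s = x
  · subst hsx
    by_cases htx : t = s
    · subst htx
      rw [sourceWeight_self, zero_add]
    · rw [sourceWeight_of_ne c t' htx, add_zero]
      have h : t ∈ Above S s := ⟨⟨ht, htx⟩, ⟨p⟩⟩
      have h' : t' ∈ Above S s := by
        refine ⟨⟨ht', fun e => ?_⟩, ⟨p.cons α⟩⟩
        cases e
        exact (hx.isEmpty _ ht).false α
      have e := Comp.mk_eq_of_arrow h h' α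
      classical exact if_congr (and_congr_right fun _ =>
        ⟨fun ⟨_, hc⟩ => ⟨h', e.symm.trans hc⟩, fun ⟨_, hc⟩ => ⟨h, e.trans hc⟩⟩) rfl rfl
  · have htx : t ≠ x := by
      rintro rfl
      exact hsx (hx.eq_of_path hS hs p)
    rw [sourceWeight_of_ne c _ hsx, sourceWeight_of_ne c _ hsx, sourceWeight_of_ne c _ htx,
      zero_add]

/-- The transport along walks of a full subquiver that adds up the weights of the arrows. -/
def sourceTransport (S : Set Q) (x : Q) (c : Comp (Above S x)) ⦃s t : FullSubquiver S⦄
    (_ : s ⟶ t) : ℤ ≃ ℤ :=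
  Equiv.addRight (sourceWeight S x c s.vertex t.vertex)

/-- Parallel paths therefore have equal transport, which makes the weight homotopy invariant
whatever the minimal relations are. -/
theorem IsSourceOf.transport_toWalk {S : Set Q} {x : Q} (hx : IsSourceOf S x) (hS : IsConvex S)
    (c : Comp (Above S x)) {s t : FullSubquiver S} (p : Quiver.Path s t) :
    transport (V := fun _ => ℤ) (sourceTransport S x c) (toWalk p)
      = Equiv.addRight (sourceWeight S x c s.vertex t.vertex) := by
  induction p with
  | nil => ext n; simp [sourceWeight_self]
  | @cons d e p α ih =>
    rw [transport_toWalk_cons, ih]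
    ext n
    simp only [sourceTransport, Equiv.trans_apply, Equiv.coe_addRight]
    rw [add_assoc, hx.sourceWeight_add hS c s.mem d.mem e.mem ((BoundQuiver.incl S).mapPath p) α]

/-- A walk can be chosen inside `S \ {x}`, and arrows that do not start at `x` have weight `0`. -/
theorem exists_transport_eq_refl {S : Set Q} {x : Q} (c : Comp (Above S x)) {y z : Q}
    (hy : y ∈ S \ {x}) (hz : z ∈ S \ {x}) (h : Comp.mk y hy = Comp.mk z hz) :
    ∃ w : Walk (⟨y, hy.1⟩ : FullSubquiver S) ⟨z, hz.1⟩,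
      transport (V := fun _ => ℤ) (sourceTransport S x c) w = Equiv.refl ℤ := by
  have key : ∀ s t : (S \ {x} : Set Q), Relation.EqvGen (fun s t => Nonempty (s.1 ⟶ t.1)) s t →
      ∃ w : Walk (⟨s.1, s.2.1⟩ : FullSubquiver S) ⟨t.1, t.2.1⟩,
        transport (V := fun _ => ℤ) (sourceTransport S x c) w = Equiv.refl ℤ := by
    intro s t h
    induction h with
    | rel s t h =>
      obtain ⟨α⟩ := h
      refine ⟨toWalk (Quiver.Path.cons .nil
        (show (⟨s.1, s.2.1⟩ : FullSubquiver S) ⟶ ⟨t.1, t.2.1⟩ from α)), ?_⟩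
      ext n
      rw [transport_toWalk_cons]
      simp [sourceTransport, sourceWeight_of_ne c t.1 s.2.2]
    | refl s => exact ⟨.nil, rfl⟩
    | symm s t _ ih =>
      obtain ⟨w, hw⟩ := ih
      refine ⟨w.reverse, ?_⟩
      rw [transport_reverse, hw]
      rfl
    | trans s t r _ _ ih ih' =>
      obtain ⟨w, hw⟩ := ih
      obtain ⟨w', hw'⟩ := ih'
      refine ⟨w.comp w', ?_⟩
      rw [transport_comp, hw, hw']
      rfl
  exact key ⟨y, hy⟩ ⟨z, hz⟩ (Quot.eqvGen_exact h)

variable {I : PathIdeal k Q}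

/-- Separation: removing a source `x` of a finite convex subcategory does not leave distinct
components of the set of proper successors of `x` connected to each other. -/
theorem IsSourceOf.incl_injective (hI' : I.IsStronglySimplyConnected) (hI : I.IsBoundQuiver)
    {S : Set Q} (hfin : S.Finite) (hS : IsConvex S) {x : Q} (hx : IsSourceOf S x) :
    Function.Injective (Comp.incl (fun _ h => h.1 : Above S x ⊆ S \ {x})) := by
  intro c d hcd
  obtain ⟨y, hy, ⟨α⟩, rfl⟩ := hx.exists_arrow hS c
  obtain ⟨z, hz, ⟨β⟩, rfl⟩ := hx.exists_arrow hS d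
  by_contra hne
  set c := Comp.mk y hy
  obtain ⟨w, hw⟩ := exists_transport_eq_refl c hy.1 hz.1 hcd
  let x₀ : FullSubquiver S := ⟨x, hx.mem⟩
  let p : Quiver.Path x₀ ⟨y, hy.1.1⟩ := .cons .nil (show x₀ ⟶ ⟨y, hy.1.1⟩ from α)
  let q : Quiver.Path x₀ ⟨z, hz.1.1⟩ := .cons .nil (show x₀ ⟶ ⟨z, hz.1.1⟩ from β)
  -- The closed walk `α w β⁻¹` is contractible, yet its weight is `1`: `α` enters `c`, `w`
  -- contributes nothing, and `β` enters another component.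
  have h := (hI'.homotopic_nil hI hfin hS
    (((toWalk p).comp w).comp (toWalk q).reverse)).transport_eq (V := fun _ => ℤ)
    (sourceTransport S x c) fun _ p _ q _ => by
      rw [hx.transport_toWalk hS c p, hx.transport_toWalk hS c q]
  rw [transport_comp, transport_comp, transport_reverse, hw, hx.transport_toWalk hS c p,
    hx.transport_toWalk hS c q] at h
  have hp : sourceWeight S x c x y = 1 := if_pos ⟨rfl, hy, rfl⟩
  have hq : sourceWeight S x c x z = 0 := if_neg fun h => hne (h.2.2.symm)
  have h0 := congrArg (fun f : ℤ ≃ ℤ => f 0) h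
  change 0 + sourceWeight S x c x y + -sourceWeight S x c x z = 0 at h0
  rw [hp, hq] at h0
  norm_num at h0

/-! ### Counting components by removing sources. -/

open Classical in
/-- Removing a source `x` merges the components of its proper successors into one. -/
def IsSourceOf.compEquiv {S : Set Q} (hS : IsConvex S) {x : Q} (hx : IsSourceOf S x) :
    Comp S ≃ Option ((Set.range (Comp.incl (fun _ h => h.1 : Above S x ⊆ S \ {x})))ᶜ : Set _) where
  toFun := Quot.lift
    (fun s => if h : s.1 = x then none else
      if h' : Comp.mk (S := S \ {x}) s.1 ⟨s.2, h⟩ ∈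
        Set.range (Comp.incl (fun _ h => h.1 : Above S x ⊆ S \ {x})) then none else some ⟨_, h'⟩)
    (by
      rintro ⟨s, hs⟩ ⟨t, ht⟩ ⟨α⟩
      have htx : t ≠ x := by
        rintro rfl
        exact (hx.isEmpty _ hs).false α
      dsimp only
      by_cases hsx : s = x
      · subst hsx
        rw [dif_pos rfl, dif_neg htx, dif_pos ⟨Comp.mk t (hx.mem_above ht α), rfl⟩]
      · have := Comp.mk_eq_of_arrow (S := S \ {x}) ⟨hs, hsx⟩ ⟨ht, htx⟩ α
        simp only [dif_neg htx, dif_neg hsx, this])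
  invFun c := c.elim (Comp.mk x hx.mem) fun c => Comp.incl Set.sdiff_subset c.1
  left_inv := by
    rintro ⟨s, hs⟩
    dsimp only
    by_cases hsx : s = x
    · subst hsx
      rw [dif_pos rfl]
      rfl
    · rw [dif_neg hsx]
      split_ifs with h
      -- A component in the range contains a successor `t` of `x`, and convexity keeps the path from
      -- `x` to `t` inside `S`.
      · obtain ⟨d, hd⟩ := h
        obtain ⟨t, ht, rfl⟩ := d.exists_mk
        obtain ⟨p⟩ := ht.2
        exact (Comp.mk_eq_of_path hS hx.mem ht.1.1 p).trans
          (congrArg (Comp.incl Set.sdiff_subset) hd)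
      · rfl
  right_inv := by
    rintro (_ | ⟨c, hc⟩)
    · exact dif_pos rfl
    · obtain ⟨s, hs, rfl⟩ := c.exists_mk
      exact (dif_neg hs.2).trans (dif_neg hc)

/-- By separation, the components of `S \ {x}` that merge with `x` are exactly as many as the
components of `Above S x`; the single component of `x` replaces them. -/
theorem IsSourceOf.card_comp (hI' : I.IsStronglySimplyConnected) (hI : I.IsBoundQuiver)
    {S : Set Q} (hfin : S.Finite) (hS : IsConvex S) {x : Q} (hx : IsSourceOf S x) :
    (Nat.card (Comp S) : ℤ) = Nat.card (Comp (S \ {x})) + (1 - Nat.card (Comp (Above S x))) := by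
  have := Comp.finite (hfin.subset (Set.sdiff_subset (t := {x})))
  rw [Nat.card_congr (hx.compEquiv hS), Finite.card_option,
    ← Nat.card_range_of_injective (hx.incl_injective hI' hI hfin hS), Nat.card_coe_set_eq,
    Nat.card_coe_set_eq, ← Set.ncard_add_ncard_compl
      (Set.range (Comp.incl (fun _ h => h.1 : Above S x ⊆ S \ {x})))]
  push_cast
  ring

/-- The number of components of a finite convex subcategory is a sum of local terms. -/
theorem card_comp_eq_sum (hI' : I.IsStronglySimplyConnected) (hI : I.IsBoundQuiver)
    (S : Finset Q) (hS : IsConvex (S : Set Q)) :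
    (Nat.card (Comp (S : Set Q)) : ℤ) = ∑ s ∈ S, (1 - (Nat.card (Comp (Above S s)) : ℤ)) := by
  classical
  induction S using Finset.strongInduction with
  | H S ih =>
    obtain rfl | hne := S.eq_empty_or_nonempty
    · have : IsEmpty (Comp ((∅ : Finset Q) : Set Q)) :=
        ⟨fun c => by obtain ⟨s, hs, -⟩ := c.exists_mk; simp at hs⟩
      rw [Finset.sum_empty, Nat.card_of_isEmpty]
      rfl
    · obtain ⟨x, hx⟩ := exists_isSourceOf hI'.triangular S.finite_toSet hne
      have hxS : x ∈ S := hx.mem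
      rw [hx.card_comp hI' hI S.finite_toSet hS, ← Finset.coe_erase,
        ih _ (Finset.erase_ssubset hxS)
          (by rw [Finset.coe_erase]; exact hx.isConvex_diff hS),
        ← Finset.sum_erase_add _ _ hxS]
      congr 1
      refine Finset.sum_congr rfl fun s hs => ?_
      -- No path leads from `s ≠ x` back to the source `x`, so the local terms of the other vertices
      -- survive the removal.
      have : Above (S.erase x : Set Q) s = Above S s := by
        ext y
        simp only [Above, Finset.coe_erase, Set.mem_ofPred_eq, Set.mem_sdiff, Set.mem_singleton_iff]
        refine ⟨fun h => ⟨⟨h.1.1.1, h.1.2⟩, h.2⟩, fun h => ⟨⟨⟨h.1.1, ?_⟩, h.1.2⟩, h.2⟩⟩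
        rintro rfl
        exact (Finset.mem_erase.1 hs).1
          (hx.eq_of_path hS (Finset.mem_erase.1 hs).2 h.2.some)
      rw [this]

end Components

/-! ### Monodromy of a Galois covering -/

section Monodromy

variable {k : Type w} [Field k] {Q' : Type u₁} [Quiver.{v₁} Q'] {Q : Type u} [Quiver.{v} Q]
  {F : Q' ⥤q Q} {I' : PathIdeal k Q'} {I : PathIdeal k Q} {G : Subgroup (Aut (Quiv.of Q'))}

/-- Quiver automorphisms act on the vertices. -/
instance : MulAction (Aut (Quiv.of Q')) Q' where
  smul g x := (autMap g).obj x
  one_smul _ := rfl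
  mul_smul _ _ _ := rfl

theorem IsGaloisCovering.obj_smul (hF : IsGaloisCovering F I' I G) {g : Aut (Quiv.of Q')}
    (hg : g ∈ G) (x : Q') : F.obj (g • x) = F.obj x :=
  congrArg (fun ψ : Q' ⥤q Q => ψ.obj x) (hF.invariant g hg)

theorem IsGaloisCovering.arrowMap_autMap (hF : IsGaloisCovering F I' I G)
    {g : Aut (Quiv.of Q')} (hg : g ∈ G) (α : Quiver.Total Q') :
    arrowMap F (arrowMap (autMap g) α) = arrowMap F α :=
  congrArg (fun ψ : Q' ⥤q Q => arrowMap ψ α) (hF.invariant g hg)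

/-- Two lifts of an arrow differ by an element of `G`; if they share their start, that element fixes
a vertex and is `1`. -/
theorem IsGaloisCovering.eq_of_left_eq (hF : IsGaloisCovering F I' I G) {α β : Quiver.Total Q'}
    (h : arrowMap F α = arrowMap F β) (hl : α.left = β.left) : α = β := by
  obtain ⟨g, hg, rfl⟩ := hF.arrow_fibre α β h
  rw [hF.free g hg α.left hl.symm]
  rfl

theorem IsGaloisCovering.eq_of_right_eq (hF : IsGaloisCovering F I' I G)
    {α β : Quiver.Total Q'} (h : arrowMap F α = arrowMap F β) (hr : α.right = β.right) :
    α = β := by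
  obtain ⟨g, hg, rfl⟩ := hF.arrow_fibre α β h
  rw [hF.free g hg α.right hr.symm]
  rfl

/-- Any lift of the arrow can be translated by `G` so that it starts at the prescribed point of the
fibre. -/
theorem IsGaloisCovering.exists_left (hF : IsGaloisCovering F I' I G) (α : Quiver.Total Q)
    (x : Q') (hx : F.obj x = α.left) : ∃ β, arrowMap F β = α ∧ β.left = x := by
  obtain ⟨β, rfl⟩ := hF.surjective_arrows α
  obtain ⟨g, hg, h⟩ := hF.vertex_fibre β.left x hx.symm
  exact ⟨arrowMap (autMap g) β, hF.arrowMap_autMap hg β, h⟩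

theorem IsGaloisCovering.exists_right (hF : IsGaloisCovering F I' I G) (α : Quiver.Total Q)
    (x : Q') (hx : F.obj x = α.right) : ∃ β, arrowMap F β = α ∧ β.right = x := by
  obtain ⟨β, rfl⟩ := hF.surjective_arrows α
  obtain ⟨g, hg, h⟩ := hF.vertex_fibre β.right x hx.symm
  exact ⟨arrowMap (autMap g) β, hF.arrowMap_autMap hg β, h⟩

/-- The fibre of a quiver map over a vertex. -/
abbrev Fibre (F : Q' ⥤q Q) (c : Q) : Type u₁ := {x : Q' // F.obj x = c}

/-- The set of lifts of an arrow, as a relation between fibres. -/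
def LiftRel (F : Q' ⥤q Q) {c d : Q} (α : c ⟶ d) (x y : Q') : Prop :=
  ∃ β : x ⟶ y, arrowMap F ⟨x, y, β⟩ = ⟨c, d, α⟩

theorem IsGaloisCovering.existsUnique_right (hF : IsGaloisCovering F I' I G) {c d : Q}
    (α : c ⟶ d) (x : Fibre F c) : ∃! y : Fibre F d, LiftRel F α x y := by
  obtain ⟨β, hβ, hx⟩ := hF.exists_left ⟨c, d, α⟩ x.1 x.2
  obtain ⟨s, t, β⟩ := β
  obtain ⟨x, hxc⟩ := x
  cases hx
  refine ⟨⟨t, congrArg Quiver.Total.right hβ⟩, ⟨β, hβ⟩, ?_⟩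
  rintro ⟨y, hy⟩ ⟨γ, hγ⟩
  exact Subtype.ext (congrArg Quiver.Total.right (hF.eq_of_left_eq (hγ.trans hβ.symm) rfl))

theorem IsGaloisCovering.existsUnique_left (hF : IsGaloisCovering F I' I G) {c d : Q}
    (α : c ⟶ d) (y : Fibre F d) : ∃! x : Fibre F c, LiftRel F α x y := by
  obtain ⟨β, hβ, hy⟩ := hF.exists_right ⟨c, d, α⟩ y.1 y.2
  obtain ⟨s, t, β⟩ := β
  obtain ⟨y, hyc⟩ := y
  cases hy
  refine ⟨⟨s, congrArg Quiver.Total.left hβ⟩, ⟨β, hβ⟩, ?_⟩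
  rintro ⟨x, hx⟩ ⟨γ, hγ⟩
  exact Subtype.ext (congrArg Quiver.Total.left (hF.eq_of_right_eq (hγ.trans hβ.symm) rfl))

/-- The bijection between fibres given by lifting an arrow. -/
def IsGaloisCovering.lift (hF : IsGaloisCovering F I' I G) ⦃c d : Q⦄ (α : c ⟶ d) :
    Fibre F c ≃ Fibre F d where
  toFun x := (hF.existsUnique_right α x).choose
  invFun y := (hF.existsUnique_left α y).choose
  left_inv x := ((hF.existsUnique_left α _).choose_spec.2 x
    (hF.existsUnique_right α x).choose_spec.1).symm
  right_inv y := ((hF.existsUnique_right α _).choose_spec.2 y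
    (hF.existsUnique_left α y).choose_spec.1).symm

theorem IsGaloisCovering.lift_eq_iff (hF : IsGaloisCovering F I' I G) {c d : Q} (α : c ⟶ d)
    (x : Fibre F c) (y : Fibre F d) : hF.lift α x = y ↔ LiftRel F α x y := by
  refine ⟨?_, fun h => ((hF.existsUnique_right α x).choose_spec.2 y h).symm⟩
  rintro rfl
  exact (hF.existsUnique_right α x).choose_spec.1

/-- The monodromy of a walk. -/
abbrev IsGaloisCovering.monodromy (hF : IsGaloisCovering F I' I G) {c d : Q} (w : Walk c d) :
    Fibre F c ≃ Fibre F d :=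
  transport (V := Fibre F) hF.lift w

/-- The action of an element of `G` on a fibre. -/
def IsGaloisCovering.act (hF : IsGaloisCovering F I' I G) {g : Aut (Quiv.of Q')} (hg : g ∈ G)
    {c : Q} (x : Fibre F c) : Fibre F c :=
  ⟨g • x.1, (hF.obj_smul hg x.1).trans x.2⟩

theorem IsGaloisCovering.lift_act (hF : IsGaloisCovering F I' I G) {g : Aut (Quiv.of Q')}
    (hg : g ∈ G) {c d : Q} (α : c ⟶ d) (x : Fibre F c) :
    hF.lift α (hF.act hg x) = hF.act hg (hF.lift α x) := by
  obtain ⟨β, hβ⟩ := (hF.lift_eq_iff α x _).1 rfl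
  exact (hF.lift_eq_iff α _ _).2 ⟨(autMap g).map β, (hF.arrowMap_autMap hg _).trans hβ⟩

theorem IsGaloisCovering.monodromy_act (hF : IsGaloisCovering F I' I G)
    {g : Aut (Quiv.of Q')} (hg : g ∈ G) {c d : Q} (w : Walk c d) (x : Fibre F c) :
    hF.monodromy w (hF.act hg x) = hF.act hg (hF.monodromy w x) := by
  induction w with
  | nil => rfl
  | cons w e ih =>
    change stepTransport (V := Fibre F) hF.lift e (hF.monodromy w _) =
      hF.act hg (stepTransport (V := Fibre F) hF.lift e (hF.monodromy w _))
    rw [ih]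
    rcases e with e | e
    · exact hF.lift_act hg e _
    · refine (hF.lift e).symm_apply_eq.2 ?_
      rw [hF.lift_act]
      exact congrArg _ ((hF.lift e).apply_symm_apply _).symm

theorem IsGaloisCovering.monodromy_mapPath (hF : IsGaloisCovering F I' I G) {x y : Q'}
    (p : Quiver.Path x y) : hF.monodromy (toWalk (F.mapPath p)) ⟨x, rfl⟩ = ⟨y, rfl⟩ := by
  induction p with
  | nil => rfl
  | @cons y z p β ih =>
    change hF.lift (F.map β) (hF.monodromy (toWalk (F.mapPath p)) ⟨x, rfl⟩) = _
    rw [ih]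
    exact (hF.lift_eq_iff _ _ _).2 ⟨β, rfl⟩

theorem IsGaloisCovering.star_injective (hF : IsGaloisCovering F I' I G) (x : Q') :
    Function.Injective (F.star x) := by
  rintro ⟨y, α⟩ ⟨z, β⟩ h
  have e : arrowMap F ⟨x, y, α⟩ = arrowMap F ⟨x, z, β⟩ :=
    congrArg (fun e : Quiver.Star (F.obj x) => (⟨F.obj x, e.1, e.2⟩ : Quiver.Total Q)) h
  cases hF.eq_of_left_eq e rfl
  rfl

theorem IsGaloisCovering.star_surjective (hF : IsGaloisCovering F I' I G) (x : Q') :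
    Function.Surjective (F.star x) := by
  rintro ⟨d, α⟩
  obtain ⟨⟨s, t, β⟩, hβ, hx⟩ := hF.exists_left ⟨_, d, α⟩ x rfl
  cases hx
  cases hβ
  exact ⟨⟨t, β⟩, rfl⟩

theorem IsGaloisCovering.mapPath_injective (hF : IsGaloisCovering F I' I G) (x y : Q') :
    Function.Injective (F.mapPath (a := x) (b := y)) :=
  mapPath_injective_of_star F hF.star_injective x y

/-- Lifting of paths. -/
theorem IsGaloisCovering.exists_mapPath (hF : IsGaloisCovering F I' I G) {x y : Q'}
    (p : Quiver.Path (F.obj x) (F.obj y))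
    (h : hF.monodromy (toWalk p) ⟨x, rfl⟩ = ⟨y, rfl⟩) :
    ∃ p' : Quiver.Path x y, F.mapPath p' = p := by
  obtain ⟨⟨z, p'⟩, hz⟩ := F.pathStar_surjective hF.star_surjective x ⟨_, p⟩
  -- The end vertex is generalised so that the equality of dependent pairs can be eliminated.
  have key : ∀ {d : Q} (p : Quiver.Path (F.obj x) d),
      F.pathStar x ⟨z, p'⟩ = ⟨d, p⟩ → (hF.monodromy (toWalk p) ⟨x, rfl⟩).1 = z := by
    rintro d p h
    cases h
    rw [hF.monodromy_mapPath]
  have hzy : z = y := (key p hz).symm.trans (congrArg Subtype.val h)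
  subst hzy
  refine ⟨p', ?_⟩
  simpa [Prefunctor.pathStar] using hz

/-- A covering functor is faithful: this is injectivity of `coveringMapFrom` on the summand at `y`.
-/
theorem IsGaloisCovering.pathMap_mem_iff (hF : IsGaloisCovering F I' I G) (x y : Q')
    (ρ : PathSpace k x y) :
    pathMap F x y ρ ∈ I.carrier (F.obj x) (F.obj y) ↔ ρ ∈ I'.carrier x y := by
  classical
  refine ⟨fun h => ?_, hF.mapsIdeal x y ρ⟩
  let f : (⟨x⟩ : BoundCat I') ⟶ ⟨y⟩ := Submodule.Quotient.mk (p := I'.carrier x y) ρ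
  have hf : (inducedFunctor F hF.mapsIdeal).map f = 0 :=
    (Submodule.Quotient.mk_eq_zero (I.carrier (F.obj x) (F.obj y))).2 h
  have h0 := (hF.isCoveringFunctor.bijective_from ⟨x⟩ ⟨F.obj y⟩).1
    (a₁ := DirectSum.of (fun y' : {y' : BoundCat I' //
      (inducedFunctor F hF.mapsIdeal).obj y' = ⟨F.obj y⟩} => ((⟨x⟩ : BoundCat I') ⟶ y'.1))
      ⟨⟨y⟩, rfl⟩ f) (a₂ := 0) (by
        rw [map_zero, coveringMapFrom, DirectSum.toAddMonoid_of]
        simp [hf])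
  have hf0 : f = 0 := by
    simpa using congrArg (fun d => d ⟨⟨y⟩, rfl⟩) h0
  exact (Submodule.Quotient.mk_eq_zero (I'.carrier x y)).1 hf0

/-! ### Homogeneity of the ideal and homotopy invariance of monodromy. -/

open Classical in
/-- The part of `ρ` that consists of the paths whose lift from `x` ends at `y`. -/
def IsGaloisCovering.part (hF : IsGaloisCovering F I' I G) (x : Q') {d : Q}
    (ρ : PathSpace k (F.obj x) d) (y : Fibre F d) : PathSpace k (F.obj x) d :=
  ρ.filter fun p => hF.monodromy (toWalk p) ⟨x, rfl⟩ = y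

theorem IsGaloisCovering.part_add (hF : IsGaloisCovering F I' I G) (x : Q') {d : Q}
    (ρ σ : PathSpace k (F.obj x) d) (y : Fibre F d) :
    hF.part x (ρ + σ) y = hF.part x ρ y + hF.part x σ y := by
  classical exact Finsupp.filter_add

theorem IsGaloisCovering.part_single_of_eq (hF : IsGaloisCovering F I' I G) (x : Q') {d : Q}
    {p : Quiver.Path (F.obj x) d} (r : k) {y : Fibre F d}
    (h : hF.monodromy (toWalk p) ⟨x, rfl⟩ = y) :
    hF.part x (Finsupp.single p r) y = Finsupp.single p r := by
  classical
  exact Finsupp.filter_single_of_pos (fun p => hF.monodromy (toWalk p) ⟨x, rfl⟩ = y) h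

theorem IsGaloisCovering.part_single_of_ne (hF : IsGaloisCovering F I' I G) (x : Q') {d : Q}
    {p : Quiver.Path (F.obj x) d} (r : k) {y : Fibre F d}
    (h : hF.monodromy (toWalk p) ⟨x, rfl⟩ ≠ y) :
    hF.part x (Finsupp.single p r) y = 0 := by
  classical
  exact Finsupp.filter_single_of_neg (fun p => hF.monodromy (toWalk p) ⟨x, rfl⟩ = y) h

/-- Lifting the paths of `ρ` from `x` and sorting them by end point gives a preimage of the class of
`ρ` under `coveringMapFrom`. That class is `0`, so by injectivity every component of the preimage
vanishes, and so do their images, the classes of the parts. -/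
theorem IsGaloisCovering.part_mem (hF : IsGaloisCovering F I' I G) (x : Q') {d : Q}
    {ρ : PathSpace k (F.obj x) d} (hρ : ρ ∈ I.carrier (F.obj x) d) (y : Fibre F d) :
    hF.part x ρ y ∈ I.carrier (F.obj x) d := by
  classical
  let Φ := inducedFunctor F hF.mapsIdeal
  have key : ∀ ρ : PathSpace k (F.obj x) d, ∃ e : DirectSum {y' : BoundCat I' // Φ.obj y' = ⟨d⟩}
      (fun y' => ((⟨x⟩ : BoundCat I') ⟶ y'.1)),
      coveringMapFrom Φ ⟨x⟩ ⟨d⟩ e = Submodule.Quotient.mk (p := I.carrier (F.obj x) d) ρ ∧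
      ∀ y : Fibre F d, Φ.map (e ⟨⟨y.1⟩, congrArg BoundCat.mk y.2⟩) ≫
          eqToHom (congrArg BoundCat.mk y.2 : Φ.obj ⟨y.1⟩ = ⟨d⟩) =
        Submodule.Quotient.mk (p := I.carrier (F.obj x) d) (hF.part x ρ y) := by
    intro ρ
    induction ρ using Finsupp.induction_linear with
    | zero =>
      refine ⟨0, map_zero _, fun y => ?_⟩
      simp only [DirectSum.zero_apply, Functor.map_zero, Limits.zero_comp, IsGaloisCovering.part,
        Finsupp.filter_zero]
      rfl
    | add f g hf hg =>
      obtain ⟨e, he, he'⟩ := hf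
      obtain ⟨e', hee, hee'⟩ := hg
      refine ⟨e + e', by rw [map_add, he, hee]; rfl, fun y => ?_⟩
      rw [DirectSum.add_apply, Functor.map_add, Preadditive.add_comp, he', hee']
      exact congrArg Submodule.Quotient.mk (hF.part_add x f g y).symm
    | single p r =>
      obtain ⟨⟨z, p'⟩, hz⟩ := F.pathStar_surjective hF.star_surjective x ⟨_, p⟩
      cases hz
      let f : (⟨x⟩ : BoundCat I') ⟶ ⟨z⟩ :=
        Submodule.Quotient.mk (p := I'.carrier x z) (Finsupp.single p' r)
      have hf : Φ.map f = Submodule.Quotient.mk (p := I.carrier (F.obj x) (F.obj z))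
          (Finsupp.single (F.mapPath p') r) :=
        congrArg Submodule.Quotient.mk Finsupp.mapDomain_single
      refine ⟨DirectSum.of (fun y' : {y' : BoundCat I' // Φ.obj y' = ⟨F.obj z⟩} =>
        ((⟨x⟩ : BoundCat I') ⟶ y'.1)) ⟨⟨z⟩, rfl⟩ f, ?_, ?_⟩
      · rw [coveringMapFrom, DirectSum.toAddMonoid_of]
        exact (Category.comp_id _).trans hf
      · intro y
        by_cases hy : (⟨z, rfl⟩ : Fibre F (F.obj z)) = y
        · subst hy
          rw [DirectSum.of_eq_same]
          refine ((Category.comp_id _).trans hf).trans ?_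
          exact congrArg Submodule.Quotient.mk
            (hF.part_single_of_eq x r (hF.monodromy_mapPath p')).symm
        · rw [DirectSum.of_eq_of_ne]
          · rw [Functor.map_zero, Limits.zero_comp]
            refine congrArg Submodule.Quotient.mk (hF.part_single_of_ne x r ?_).symm
            exact fun h => hy ((hF.monodromy_mapPath p').symm.trans h)
          · intro h
            exact hy (Subtype.ext (congrArg (fun y' => y'.1.vertex) h).symm)
  obtain ⟨e, he, he'⟩ := key ρ
  have he0 : e = 0 := (hF.isCoveringFunctor.bijective_from ⟨x⟩ ⟨d⟩).1 (by
    rw [map_zero]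
    exact he.trans ((Submodule.Quotient.mk_eq_zero _).2 hρ))
  refine (Submodule.Quotient.mk_eq_zero _).1 ((he' y).symm.trans ?_)
  rw [he0, DirectSum.zero_apply, Functor.map_zero, Limits.zero_comp]
  rfl

/-- If the lifts of `p` and `q` from some `x` ended differently, the paths whose lifts end where
that of `p` does would form a nonempty proper subsum in `I`, against minimality. -/
theorem IsGaloisCovering.monodromy_eq_of_isMinimalRelation (hF : IsGaloisCovering F I' I G)
    {c d : Q} {ρ : PathSpace k c d} (hρ : IsMinimalRelation I ρ) {p q : Quiver.Path c d}
    (hp : p ∈ ρ.support) (hq : q ∈ ρ.support) :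
    hF.monodromy (toWalk p) = hF.monodromy (toWalk q) := by
  classical
  ext1 ⟨x, hx⟩
  subst hx
  by_contra hne
  set y := hF.monodromy (toWalk p) ⟨x, rfl⟩
  have h := hF.part_mem x hρ.mem y
  refine hρ.minimal (hF.part x ρ y).support ?_ ⟨p, ?_⟩ ?_
  · rw [IsGaloisCovering.part, Finsupp.support_filter]
    exact Finset.filter_ssubset.2 ⟨q, hq, fun e => hne e.symm⟩
  · rw [IsGaloisCovering.part, Finsupp.support_filter]
    exact Finset.mem_filter.2 ⟨hp, rfl⟩
  · convert h using 1
    conv_rhs => rw [← Finsupp.sum_single (hF.part x ρ y)]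
    refine Finset.sum_congr rfl fun r hr => ?_
    rw [IsGaloisCovering.part, Finsupp.support_filter] at hr
    exact congrArg _ (Finsupp.filter_apply_pos (fun p => hF.monodromy (toWalk p) ⟨x, rfl⟩ = y)
      ρ (Finset.mem_filter.1 hr).2).symm

theorem IsGaloisCovering.monodromy_eq_of_homotopic (hF : IsGaloisCovering F I' I G)
    {c d : Q} {w w' : Walk c d} (H : Homotopic I w w') : hF.monodromy w = hF.monodromy w' :=
  H.transport_eq _ fun hρ _ hp _ hq => hF.monodromy_eq_of_isMinimalRelation hρ hp hq

end Monodromy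

/-! ### Convex hulls -/

section Hull

variable {k : Type w} [Field k] {Q : Type u} [Quiver.{v} Q]

/-- The convex hull of a set of vertices. -/
def hull (V : Set Q) : Set Q :=
  {s | ∃ a ∈ V, ∃ c ∈ V, Nonempty (Quiver.Path a s) ∧ Nonempty (Quiver.Path s c)}

theorem subset_hull (V : Set Q) : V ⊆ hull V := fun s hs => ⟨s, hs, s, hs, ⟨.nil⟩, ⟨.nil⟩⟩

theorem isConvex_hull (V : Set Q) : IsConvex (hull V) := by
  rintro s t r ⟨a, ha, -, -, ⟨p⟩, -⟩ ⟨-, -, c, hc, -, ⟨q⟩⟩ p' q'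
  exact ⟨a, ha, c, hc, ⟨p.comp p'⟩, ⟨q'.comp q⟩⟩

/-- Every vertex of the hull lies on one of the finitely many paths between members of `V`. -/
theorem finite_hull (hQ : ∀ x y : Q, Finite (Quiver.Path x y)) {V : Set Q} (hV : V.Finite) :
    (hull V).Finite := by
  have h : (⋃ a ∈ V, ⋃ c ∈ V, ⋃ r : Quiver.Path a c, {s | s ∈ r.vertices}).Finite :=
    hV.biUnion fun a _ => hV.biUnion fun c _ => Set.finite_iUnion fun r => r.vertices.finite_toSet
  refine h.subset ?_
  rintro s ⟨a, ha, c, hc, ⟨p⟩, ⟨q⟩⟩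
  simp only [Set.mem_iUnion]
  refine ⟨a, ha, c, hc, p.comp q, ?_⟩
  change s ∈ (p.comp q).vertices
  rw [Quiver.Path.vertices_comp]
  exact List.mem_append_right _ q.start_mem_vertices

theorem walkMap_contourWalk {W : Type u₁} [Quiver.{v₁} W] (ψ : Q ⥤q W) {a b : Q}
    (p q : Quiver.Path a b) :
    walkMap ψ (contourWalk p q) = contourWalk (ψ.mapPath p) (ψ.mapPath q) := by
  rw [contourWalk, walkMap_comp, walkMap_reverse, walkMap_toWalk, walkMap_toWalk]
  rfl

/-- In a strongly simply connected category all contours are contractible. -/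
theorem PathIdeal.IsStronglySimplyConnected.isContractible_contourWalk {I : PathIdeal k Q}
    (hI' : I.IsStronglySimplyConnected) (hI : I.IsBoundQuiver) {a b : Q}
    (p q : Quiver.Path a b) : IsContractible I (contourWalk p q) := by
  have hS := isConvex_hull ({a, b} : Set Q)
  have hfin := finite_hull hI'.finite_paths (Set.toFinite ({a, b} : Set Q))
  let a₀ : FullSubquiver (hull ({a, b} : Set Q)) := ⟨a, subset_hull _ (by simp)⟩
  let b₀ : FullSubquiver (hull ({a, b} : Set Q)) := ⟨b, subset_hull _ (by simp)⟩
  obtain ⟨p, rfl⟩ := exists_mapPath_incl hS (a := a₀) (b := b₀) p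
  obtain ⟨q, rfl⟩ := exists_mapPath_incl hS (a := a₀) (b := b₀) q
  have h := (hI'.homotopic_nil hI hfin hS (contourWalk p q)).map _
    (mapPath_incl_injective _) fun _ _ ρ => mem_kernel_toBoundCat I _ ρ
  rw [walkMap_contourWalk] at h
  exact h

end Hull

/-! ### Free actions -/

section FreeActions

variable {k : Type w} [Field k] {Q : Type u} [Quiver.{v} Q]

/-- `T` is a disjoint union of free orbits, each with `Nat.card H` elements, and `f` is constant on
each. -/
theorem card_dvd_sum_of_free {H : Type u₁} {X : Type u₂} [Group H] [Finite H] [MulAction H X]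
    {T : Finset X} {f : X → ℤ} (hT : ∀ (h : H), ∀ s ∈ T, h • s ∈ T)
    (hf : ∀ (h : H) (s : X), f (h • s) = f s) (hfree : ∀ (h : H) (s : X), h • s = s → h = 1) :
    (Nat.card H : ℤ) ∣ ∑ s ∈ T, f s := by
  classical
  have := Fintype.ofFinite H
  let π : X → MulAction.orbitRel.Quotient H X := Quotient.mk _
  rw [← Finset.sum_fiberwise_of_maps_to (t := T.image π) (g := π)
    fun s hs => Finset.mem_image_of_mem π hs]
  refine Finset.dvd_sum fun ω hω => ?_
  obtain ⟨s, hs, rfl⟩ := Finset.mem_image.1 hω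
  have hfib : T.filter (fun t => π t = π s) = Finset.univ.image fun h : H => h • s := by
    ext t
    simp only [Finset.mem_filter, Finset.mem_image, Finset.mem_univ, true_and]
    constructor
    · rintro ⟨-, ht⟩
      exact Quotient.exact (s := MulAction.orbitRel H X) ht
    · rintro ⟨h, rfl⟩
      exact ⟨hT h s hs, Quotient.sound (s := MulAction.orbitRel H X) ⟨h, rfl⟩⟩
  have hinj : Function.Injective fun h : H => h • s := fun h h' e => by
    have := hfree (h'⁻¹ * h) s (by rw [mul_smul]; exact inv_smul_eq_iff.2 e)
    exact (inv_mul_eq_one.1 this).symm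
  rw [hfib, Finset.sum_image fun _ _ _ _ e => hinj e, Finset.sum_congr rfl fun h _ => hf h s,
    Finset.sum_const, Finset.card_univ, Nat.card_eq_fintype_card, nsmul_eq_mul]
  exact dvd_mul_right _ _

theorem nonempty_path_smul (g : Aut (Quiv.of Q)) {s t : Q} (h : Nonempty (Quiver.Path s t)) :
    Nonempty (Quiver.Path (g • s) (g • t)) :=
  h.map (autMap g).mapPath

theorem card_comp_smul (g : Aut (Quiv.of Q)) {S T : Set Q} (h : ∀ s ∈ S, g • s ∈ T)
    (h' : ∀ t ∈ T, g⁻¹ • t ∈ S) : Nat.card (Comp S) = Nat.card (Comp T) := by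
  refine Nat.card_congr ⟨Comp.map (autMap g) h, Comp.map (autMap g⁻¹) h', ?_, ?_⟩
  · rintro ⟨s, hs⟩
    exact congrArg (Quot.mk _) (Subtype.ext (inv_smul_smul g s))
  · rintro ⟨s, hs⟩
    exact congrArg (Quot.mk _) (Subtype.ext (smul_inv_smul g s))

theorem smul_mem_above (g : Aut (Quiv.of Q)) {T : Set Q} (hT : ∀ t ∈ T, g • t ∈ T) {s t : Q}
    (ht : t ∈ Above T s) : g • t ∈ Above T (g • s) :=
  ⟨⟨hT t ht.1.1, fun h => ht.1.2 (MulAction.injective g h)⟩, nonempty_path_smul g ht.2⟩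

/-- A finite group of automorphisms that acts freely on the vertices, and preserves a nonempty
finite connected convex subcategory of a strongly simply connected category, is trivial. -/
theorem PathIdeal.IsStronglySimplyConnected.card_eq_one {I : PathIdeal k Q}
    (hI' : I.IsStronglySimplyConnected) (hI : I.IsBoundQuiver)
    (H : Subgroup (Aut (Quiv.of Q))) [Finite H]
    (hfree : ∀ h ∈ H, ∀ s : Q, h • s = s → h = 1) {T : Set Q} (hfin : T.Finite)
    (hT : IsConvex T) (hHT : ∀ h ∈ H, ∀ s ∈ T, h • s ∈ T) (hconn : Nat.card (Comp T) = 1) :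
    Nat.card H = 1 := by
  have hsum := card_comp_eq_sum hI' hI hfin.toFinset (by rwa [hfin.coe_toFinset])
  rw [hfin.coe_toFinset, hconn] at hsum
  have hdvd : (Nat.card H : ℤ) ∣
      ∑ s ∈ hfin.toFinset, (1 - (Nat.card (Comp (Above T s)) : ℤ)) := by
    refine card_dvd_sum_of_free (H := H) (fun h s hs => ?_) (fun h s => ?_) fun h s e => ?_
    · rw [Set.Finite.mem_toFinset] at hs ⊢
      exact hHT h.1 h.2 s hs
    · refine congrArg (fun n : ℕ => 1 - (n : ℤ)) (card_comp_smul h.1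
        (fun t ht => smul_mem_above h.1 (hHT _ h.2) ht) fun t ht => ?_).symm
      have := smul_mem_above h.1⁻¹ (hHT _ (H.inv_mem h.2)) ht
      rwa [inv_smul_smul] at this
    · exact Subtype.ext (hfree h.1 h.2 s e)
  rw [← hsum] at hdvd
  exact Nat.dvd_one.1 (by exact_mod_cast hdvd)

/-- In a strongly simply connected category, two paths with a common end point cannot start in
distinct points of the orbit of a free automorphism of finite order. -/
theorem PathIdeal.IsStronglySimplyConnected.eq_one_of_paths {I : PathIdeal k Q}
    (hI' : I.IsStronglySimplyConnected) (hI : I.IsBoundQuiver) {g : Aut (Quiv.of Q)}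
    (hg : IsOfFinOrder g) (hfree : ∀ h ∈ Subgroup.zpowers g, ∀ s : Q, h • s = s → h = 1)
    {x y : Q} (p : Quiver.Path x y) (q : Quiver.Path (g • x) y) : g = 1 := by
  let H := Subgroup.zpowers g
  have hHfin : Finite H := (finite_zpowers.2 hg).to_subtype
  -- The orbits of both `x` and `y` are included so that every translate of `p` and `q` has its end
  -- points in the hull.
  let V : Set Q := {s | ∃ h ∈ H, s = h • x ∨ s = h • y}
  have hV : V.Finite := by
    have := (Set.finite_range fun h : H => h.1 • x).union (Set.finite_range fun h : H => h.1 • y)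
    refine this.subset ?_
    rintro s ⟨h, hh, rfl | rfl⟩
    exacts [Or.inl ⟨⟨h, hh⟩, rfl⟩, Or.inr ⟨⟨h, hh⟩, rfl⟩]
  have hconv := isConvex_hull V
  have hVH : ∀ h ∈ H, ∀ s ∈ V, h • s ∈ V := by
    rintro h hh s ⟨h', hh', rfl | rfl⟩
    exacts [⟨h * h', H.mul_mem hh hh', Or.inl (mul_smul _ _ _).symm⟩,
      ⟨h * h', H.mul_mem hh hh', Or.inr (mul_smul _ _ _).symm⟩]
  have hTH : ∀ h ∈ H, ∀ s ∈ hull V, h • s ∈ hull V := by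
    rintro h hh s ⟨a, ha, c, hc, hp, hq⟩
    exact ⟨h • a, hVH h hh a ha, h • c, hVH h hh c hc, nonempty_path_smul h hp,
      nonempty_path_smul h hq⟩
  have hx : ∀ h ∈ H, h • x ∈ hull V := fun h hh => subset_hull V ⟨h, hh, Or.inl rfl⟩
  have hy : ∀ h ∈ H, h • y ∈ hull V := fun h hh => subset_hull V ⟨h, hh, Or.inr rfl⟩
  have hx₁ : x ∈ hull V := hx 1 H.one_mem
  have hxy : ∀ h (hh : h ∈ H), Comp.mk (h • x) (hx h hh) = Comp.mk (h • y) (hy h hh) :=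
    fun h hh => Comp.mk_eq_of_path hconv _ _ (nonempty_path_smul h ⟨p⟩).some
  -- Translates of `p` and `q` by `g ^ n` join `g ^ n • x` and `g ^ (n + 1) • x` to `g ^ n • y`.
  have hpow : ∀ (n : ℕ) (hn : g ^ n ∈ H), Comp.mk (g ^ n • x) (hx _ hn) = Comp.mk x hx₁ := by
    intro n
    induction n with
    | zero => exact fun _ => rfl
    | succ n ih =>
      intro hn
      have hn' : g ^ n ∈ H := H.pow_mem (Subgroup.mem_zpowers g) n
      rw [← ih hn', hxy _ hn']
      refine Comp.mk_eq_of_path hconv _ _ ?_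
      rw [pow_succ, mul_smul]
      exact (nonempty_path_smul (g ^ n) ⟨q⟩).some
  have hHx : ∀ h (hh : h ∈ H), Comp.mk (h • x) (hx h hh) = Comp.mk x hx₁ := by
    intro h hh
    -- As `g` has finite order, natural exponents exhaust the group it generates.
    obtain ⟨n, rfl⟩ := hg.mem_powers_iff_mem_zpowers.2 hh
    exact hpow n hh
  have hconn : Nat.card (Comp (hull V)) = 1 := by
    refine Nat.card_eq_one_iff_unique.2 ⟨⟨?_⟩, ⟨Comp.mk x hx₁⟩⟩
    suffices ∀ c : Comp (hull V), c = Comp.mk x hx₁ from fun c d => (this c).trans (this d).symm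
    intro c
    obtain ⟨s, hs, rfl⟩ := c.exists_mk
    obtain ⟨a, ha, -, -, ⟨r⟩, -⟩ := id hs
    rw [← Comp.mk_eq_of_path hconv (subset_hull V ha) hs r]
    obtain ⟨h, hh, rfl | rfl⟩ := ha
    · exact hHx h hh
    · exact (hxy h hh).symm.trans (hHx h hh)
  have hcard := hI'.card_eq_one hI H hfree (finite_hull hI'.finite_paths hV) hconv hTH hconn
  exact Subgroup.zpowers_eq_bot.1 (Subgroup.card_eq_one.1 hcard)

end FreeActions

/-! ### Torsion contours. -/

section TorsionContours

variable {k : Type w} [Field k] {Q' : Type u₁} [Quiver.{v₁} Q'] {Q : Type u} [Quiver.{v} Q]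
  {F : Q' ⥤q Q} {I' : PathIdeal k Q'} {I : PathIdeal k Q} {G : Subgroup (Aut (Quiv.of Q'))}

theorem IsGaloisCovering.nonempty_path (hF : IsGaloisCovering F I' I G) {c d : Q}
    {p : Quiver.Path c d} {x : Fibre F c} {y : Fibre F d} (h : hF.monodromy (toWalk p) x = y) :
    Nonempty (Quiver.Path x.1 y.1) := by
  obtain ⟨x, rfl⟩ := x
  obtain ⟨y, rfl⟩ := y
  obtain ⟨p', -⟩ := hF.exists_mapPath p h
  exact ⟨p'⟩

theorem IsGaloisCovering.monodromy_iterate (hF : IsGaloisCovering F I' I G)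
    {g : Aut (Quiv.of Q')} (hg : g ∈ G) {c : Q} {w : Walk c c} {x : Fibre F c}
    (h : hF.monodromy w x = hF.act hg x) (n : ℕ) :
    ((hF.monodromy w)^[n] x).1 = g ^ n • x.1 := by
  suffices (hF.monodromy w)^[n] x = hF.act (G.pow_mem hg n) x from congrArg Subtype.val this
  induction n with
  | zero => rfl
  | succ n ih =>
    rw [Function.iterate_succ_apply', ih, hF.monodromy_act, h]
    refine Subtype.ext ?_
    change g ^ n • g • x.1 = g ^ (n + 1) • x.1
    rw [pow_succ, mul_smul]

/-- A contour of `(Q, I)` that lifts to a contour of a strongly simply connected Galois covering is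
contractible. -/
theorem IsGaloisCovering.isContractible_contourWalk (hF : IsGaloisCovering F I' I G)
    (hI' : I'.IsBoundQuiver) (hssc : I'.IsStronglySimplyConnected) {a b : Q}
    (p q : Quiver.Path a b) {x : Fibre F a}
    (h : hF.monodromy (toWalk p) x = hF.monodromy (toWalk q) x) :
    IsContractible I (contourWalk p q) := by
  obtain ⟨y, hy⟩ : ∃ y, hF.monodromy (toWalk p) x = y := ⟨_, rfl⟩
  obtain ⟨x, rfl⟩ := x
  obtain ⟨y, rfl⟩ := y
  obtain ⟨p, rfl⟩ := hF.exists_mapPath p hy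
  obtain ⟨q, rfl⟩ := hF.exists_mapPath q (h.symm.trans hy)
  have := (hssc.isContractible_contourWalk hI' p q).map F hF.mapPath_injective hF.pathMap_mem_iff
  rw [walkMap_contourWalk] at this
  exact this

/-- A bound quiver with a strongly simply connected Galois covering has no torsion contours. -/
theorem IsGaloisCovering.not_isTorsionContour (hF : IsGaloisCovering F I' I G)
    (hI' : I'.IsBoundQuiver) (hssc : I'.IsStronglySimplyConnected) {a b : Q}
    (p q : Quiver.Path a b) : ¬ IsTorsionContour I p q := by
  rintro ⟨-, hnc, n, hn, hcon⟩
  obtain ⟨x, hx⟩ := hF.surjective_vertices a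
  let x₀ : Fibre F a := ⟨x, hx⟩
  obtain ⟨g, hg, hgx⟩ := hF.vertex_fibre x (hF.monodromy (contourWalk p q) x₀).1
    (hx.trans (hF.monodromy (contourWalk p q) x₀).2.symm)
  have hw : hF.monodromy (contourWalk p q) x₀ = hF.act hg x₀ := Subtype.ext hgx.symm
  -- The monodromy of the contour is that of `p` followed by the inverse of that of `q`, so the
  -- lifts of `p` from `x` and of `q` from `g • x` end at the same vertex.
  have hpq : hF.monodromy (toWalk p) x₀ = hF.monodromy (toWalk q) (hF.act hg x₀) := by
    have h : hF.monodromy (contourWalk p q)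
        = (hF.monodromy (toWalk p)).trans (hF.monodromy (toWalk q)).symm :=
      (transport_comp _ _ _).trans (congrArg _ (transport_reverse _ _))
    rw [← hw, h]
    exact ((hF.monodromy (toWalk q)).apply_symm_apply _).symm
  -- The `n`-th power of the contour acts trivially on the fibre, so `g ^ n` fixes `x`.
  have hgn : g ^ n = 1 := by
    refine hF.free _ (G.pow_mem hg n) x ((hF.monodromy_iterate hg hw n).symm.trans ?_)
    rw [← transport_pow]
    exact congrArg (fun e => (e x₀).1) (hF.monodromy_eq_of_homotopic hcon)
  obtain ⟨u⟩ := hF.nonempty_path (p := p) (x := x₀) rfl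
  obtain ⟨v⟩ := hF.nonempty_path hpq.symm
  have hg1 : g = 1 := hssc.eq_one_of_paths hI' (isOfFinOrder_iff_pow_eq_one.2 ⟨n, by omega, hgn⟩)
    (fun h hh s e => hF.free h ((Subgroup.zpowers_le.2 hg) hh) s e) u v
  subst hg1
  -- With `g = 1`, `hpq` says that both lifts start at `x` and end at the same vertex.
  exact hnc (hF.isContractible_contourWalk hI' hssc p q hpq)

end TorsionContours

end BoundQuiver

end

theorem mainTheorem4
    {k : Type w} [Field k] [IsAlgClosed k]
    {Q : Type u} [Quiver.{v} Q] [Finite Q]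
    (I : BoundQuiver.PathIdeal k Q) (hI : I.IsBoundQuiver) (hQ : BoundQuiver.IsTriangular Q)
    {Q' : Type u₁} [Quiver.{v₁} Q']
    (I' : BoundQuiver.PathIdeal k Q') (hI' : I'.IsBoundQuiver)
    (F : Q' ⥤q Q) (G : Subgroup (CategoryTheory.Aut (CategoryTheory.Quiv.of Q')))
    (hF : BoundQuiver.IsGaloisCovering F I' I G)
    (hI'_ssc : I'.IsStronglySimplyConnected)
    {a b : Q} (p q : Quiver.Path a b) (hpq : BoundQuiver.IsContour p q) :
    ¬ BoundQuiver.IsTorsionContour I p q :=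
  hF.not_isTorsionContour hI' hI'_ssc p q
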